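/- Let $\beta,\gamma>0$ with $\beta+2\gamma<1$, and write $[N]=\{1,\dots,N\}$ and $p_{i,j}=\frac{\beta N^{2\gamma-1}}{i^\gamma j^\gamma}\wedge 1$ for $i,j\in[N]$. Let $(G_N)_{N\ge1}$ be a sequence of random simple graphs in the class $\mathcal G_{\beta,\gamma}$; that is, $G_N$ has vertex set $[N]$ and for every $N$ there is a symmetric array $(q_{i,j})_{i\neq j\in[N]}$ (depending on $N$) of numbers in $(0,\frac12)$ such that each edge $\{i,j\}$, $i\ne j$, is present in $G_N$ independently of all others with probability $q_{i,j}$, and $$\lim_{N\to\infty}\sum_{i\ne j}\frac{(p_{i,j}-q_{i,j})^2}{p_{i,j}}=0 .$$ Let $\operatorname{d}(v)$ be the degree of $v$ in $G_N$, let $\mathscr C(i)$ be the connected component of $G_N$ containing the vertex $i$, and let $$K_\gamma=N^{\frac{1-2\gamma}{2-2\gamma}}\log N,\qquad V_{\rm big}=\bigcup_{i\in[N],\, i\le K_\gamma}V(\mathscr C(i)).$$ Then the following hold. (a) As $N\to\infty$, $$\mathbb P\Big(\max_{k\le K_\gamma}\frac{\sum_{z\in\mathscr C(k)}\operatorname{d}(z)}{(N/k)^\gamma}\le\log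 N\Big)\to1 .$$ (b) $\max_{i\notin V_{\rm big}}\sum_{v\in\mathscr C(i)}\operatorname{d}(v)=O_{\mathbb P}^{\log N}\big(N^{\frac{\gamma}{2-2\gamma}}\big)$; that is, there is a constant $K>0$ such that, as $N\to\infty$, $$\mathbb P\Big(\max_{i\notin V_{\rm big}}\sum_{v\in\mathscr C(i)}\operatorname{d}(v)\le N^{\frac{\gamma}{2-2\gamma}}(\log N)^K\Big)\to1 ,$$ where the maximum over the empty set is $0$. -/

import Mathlib

open MeasureTheory ProbabilityTheory Filter Topology

noncomputable section

namespace SubcriticalIRG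

/-- The vertex set `[N] = {1, …, N}`. -/
abbrev Vtx (N : ℕ) : Type := {i : ℕ // i ∈ Finset.Icc 1 N}

/-- Chung-Lu connection probabilities `p_{ij} = (β N^{2γ-1} / (i^γ j^γ)) ∧ 1`. -/
def clProb (β γ : ℝ) (N : ℕ) (i j : Vtx N) : ℝ :=
  min (β * (N : ℝ) ^ (2 * γ - 1) / ((i.1 : ℝ) ^ γ * (j.1 : ℝ) ^ γ)) 1

/-- `G` is a random simple graph on `[N]` in which each edge `{i,j}`, `i ≠ j`, is present
independently of all others with probability `q i j` (each unordered pair is represented once,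
with `i < j`). -/
structure HasIndepEdges {Ω : Type*} [MeasurableSpace Ω] (μ : Measure Ω) {N : ℕ}
    (G : Ω → SimpleGraph (Vtx N)) (q : Vtx N → Vtx N → ℝ) : Prop where
  measurable_edge : ∀ i j : Vtx N, i < j → MeasurableSet {ω | (G ω).Adj i j}
  prob_edge : ∀ i j : Vtx N, i < j → μ {ω | (G ω).Adj i j} = ENNReal.ofReal (q i j)
  indep_edge : iIndepSet
    (fun e : {e : Vtx N × Vtx N // e.1 < e.2} => {ω | (G ω).Adj e.1.1 e.1.2}) μ

/-- The sequence of random graphs `(G N)` is in the class `𝒢_{β,γ}`. -/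
def InClass (β γ : ℝ) {Ω : ℕ → Type*} [∀ N, MeasurableSpace (Ω N)]
    (μ : ∀ N, Measure (Ω N)) (G : ∀ N, Ω N → SimpleGraph (Vtx N)) : Prop :=
  ∃ q : ∀ N, Vtx N → Vtx N → ℝ,
    (∀ N i j, q N i j = q N j i) ∧
    (∀ N i j, i ≠ j → q N i j ∈ Set.Ioo (0 : ℝ) (1 / 2)) ∧
    (∀ N, HasIndepEdges (μ N) (G N) (q N)) ∧
    Tendsto (fun N : ℕ => ∑ e ∈ (Finset.univ : Finset (Vtx N)).offDiag,
      (clProb β γ N e.1 e.2 - q N e.1 e.2) ^ 2 / clProb β γ N e.1 e.2) atTop (𝓝 0)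

/-- The threshold `K_γ = N^{(1-2γ)/(2-2γ)} log N`. -/
def kGamma (γ : ℝ) (N : ℕ) : ℝ :=
  (N : ℝ) ^ ((1 - 2 * γ) / (2 - 2 * γ)) * Real.log N

open Classical in
/-- The total degree `∑_{v ∈ 𝒞(k)} d(v)` of the connected component `𝒞(k)` of `k` in `G`. -/
def totalDegree {N : ℕ} (G : SimpleGraph (Vtx N)) (k : Vtx N) : ℕ :=
  ∑ v ∈ (G.connectedComponentMk k).supp.toFinset, G.degree v

/-- `V_big`, the union of the vertex sets of the components `𝒞(i)` over `i ≤ K_γ`. -/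
def vBig (γ : ℝ) {N : ℕ} (G : SimpleGraph (Vtx N)) : Set (Vtx N) :=
  ⋃ i ∈ {i : Vtx N | (i.1 : ℝ) ≤ kGamma γ N}, (G.connectedComponentMk i).supp

open Classical in
/-- `max_{i ∉ V_big} ∑_{v ∈ 𝒞(i)} d(v)`, the maximal total degree of a small component
(equal to `0` if there is no small component). -/
def maxSmallTotalDegree (γ : ℝ) {N : ℕ} (G : SimpleGraph (Vtx N)) : ℕ :=
  (Finset.univ.filter fun i : Vtx N => i ∉ vBig γ G).sup (totalDegree G)

/-- The event `A N` holds with high probability: its probability tends to `1`. -/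
def WHP {Ω : ℕ → Type*} [∀ N, MeasurableSpace (Ω N)] (μ : ∀ N, Measure (Ω N))
    (A : ∀ N, Set (Ω N)) : Prop :=
  Tendsto (fun N => μ N (A N)) atTop (𝓝 1)

/-- `X_N = O_ℙ^{log N}(Y_N)`: for some `K > 0`, `ℙ(X_N ≤ Y_N (log N)^K) → 1`. -/
def IsBigOPLog {Ω : ℕ → Type*} [∀ N, MeasurableSpace (Ω N)] (μ : ∀ N, Measure (Ω N))
    (X Y : ∀ N, Ω N → ℝ) : Prop :=
  ∃ K : ℝ, 0 < K ∧ WHP μ fun N => {ω | X N ω ≤ Y N ω * Real.log N ^ K}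

end SubcriticalIRG

end

/-!
The graph is compared with the Chung–Lu graph, whose edge probabilities are bounded by the rank-one
kernel `β w_i w_j / N` with weights `w_i = (N / i) ^ γ`.

**Contiguity.** The second moment of the likelihood ratio of the two laws is at most
`exp (∑ (p - q)² / (p (1 - p)))`, which stays bounded. By Cauchy–Schwarz the probability of any
event is at most a constant times the square root of its probability for the Chung–Lu graph
(`InClass.exists_measure_le_sqrt`).

**Exploration.** Revealing the edges at a growing cluster one at a time shows that a potential which
does not increase on average bounds the expectation of a functional of the cluster
(`percExp_le_of_potential`). As the mean offspring number `β / (1 - 2 γ)` is less than `1`, a linear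
potential gives `ℙ (j ∈ 𝒞(k)) ≤ C w_k w_j / N`, and an exponential one gives
`𝔼 exp (θ D) ≤ exp (κ θ w_k)` for the number `D` of edges of the cluster of `k` inside a vertex set
`W`, as soon as `(β / N) ∑_{u ∈ W} w_u (exp ((1 + κ) θ w_u) - 1) ≤ κ θ`
(`percExp_clEdgeProb_exp_clusterEdges_le`).

**Small components.** A component without the first `K_γ` vertices has weights at most
`M = N ^ (γ / (2 - 2 γ))`. With `θ` a small multiple of `1 / M` the condition above holds, and a
Chernoff bound gives at most `O(M log N)` edges, uniformly over all such components.

**Large components.** Put `α = (1 - γ) / γ`, the tail exponent of the size-biased weights. The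
expected number of pairs `k ≤ K_γ` and `j ∈ 𝒞(k)` with `w_j > c w_k log N` is of order
`(log N) ^ (-α) ∑_{k ≤ K_γ} w_k ^ (1 - α)`, at most `(log N) ^ (-(1 - γ) (1 / γ - 2))`, which tends
to `0`. Without such pairs the cluster of `k` stays inside `{u | w_u ≤ c w_k log N}`. There
`θ = 8 / w_k` is admissible for a small `c`: the weights above a small multiple of `w_k` contribute
at most `N ^ (η / 2) w_k ^ (-α)`, which is much smaller than `1 / w_k` because `w_k ^ (1 - α)` is
essentially at most `N ^ (-η)`, where `η = (1 - 2 γ) / (2 - 2 γ)`. The Chernoff bound at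
`w_k log N / 2` is then of order `N ^ (-4)`, which leaves room for the square root and for the union
over `k`.
-/

namespace SubcriticalIRG

/-! ### Random subsets of a finite set -/

section RandomSubset

variable {E : Type*} [DecidableEq E]

/-- The expectation of `f A` for the random subset `A` of `T` that contains each `e ∈ T`
independently with probability `p e`. -/
noncomputable def percExp (p : E → ℝ) (T : Finset E) (f : Finset E → ℝ) : ℝ :=
  ∑ A ∈ T.powerset, (∏ e ∈ A, p e) * (∏ e ∈ T \ A, (1 - p e)) * f A

theorem percExp_insert (p : E → ℝ) {T : Finset E} {e : E} (he : e ∉ T) (f : Finset E → ℝ) :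
    percExp p (insert e T) f =
      (1 - p e) * percExp p T f + p e * percExp p T (fun A => f (insert e A)) := by
  unfold percExp
  rw [Finset.sum_powerset_insert he, Finset.mul_sum, Finset.mul_sum]
  congr 1
  · refine Finset.sum_congr rfl fun A hA => ?_
    have hA' : e ∉ A := fun h => he (Finset.mem_powerset.1 hA h)
    rw [Finset.insert_sdiff_of_notMem _ hA',
      Finset.prod_insert (fun h => he (Finset.mem_sdiff.1 h).1)]
    ring
  · refine Finset.sum_congr rfl fun A hA => ?_
    have hA' : e ∉ A := fun h => he (Finset.mem_powerset.1 hA h)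
    have h1 : insert e T \ insert e A = T \ A := by
      ext x
      simp only [Finset.mem_sdiff, Finset.mem_insert, not_or]
      constructor
      · rintro ⟨rfl | h, h2, h3⟩
        · exact absurd rfl h2
        · exact ⟨h, h3⟩
      · rintro ⟨h, h3⟩
        exact ⟨Or.inr h, fun hx => he (hx ▸ h), h3⟩
    rw [h1, Finset.prod_insert hA']
    ring

theorem percExp_weight_nonneg {p : E → ℝ} {T A : Finset E} (hp0 : ∀ e ∈ T, 0 ≤ p e)
    (hp1 : ∀ e ∈ T, p e ≤ 1) (hA : A ∈ T.powerset) :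
    0 ≤ (∏ e ∈ A, p e) * (∏ e ∈ T \ A, (1 - p e)) :=
  mul_nonneg (Finset.prod_nonneg fun e he => hp0 e (Finset.mem_powerset.1 hA he))
    (Finset.prod_nonneg fun e he => sub_nonneg.2 (hp1 e (Finset.mem_sdiff.1 he).1))

theorem percExp_mono {p : E → ℝ} {T : Finset E} (hp0 : ∀ e ∈ T, 0 ≤ p e)
    (hp1 : ∀ e ∈ T, p e ≤ 1) {f g : Finset E → ℝ} (h : ∀ A ⊆ T, f A ≤ g A) :
    percExp p T f ≤ percExp p T g :=
  Finset.sum_le_sum fun A hA => mul_le_mul_of_nonneg_left (h A (Finset.mem_powerset.1 hA))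
    (percExp_weight_nonneg hp0 hp1 hA)

theorem percExp_congr {p p' : E → ℝ} {T : Finset E}
    (h : ∀ e ∈ T, p e = p' e) (f : Finset E → ℝ) : percExp p T f = percExp p' T f := by
  refine Finset.sum_congr rfl fun A hA => ?_
  have h1 : ∏ e ∈ A, p e = ∏ e ∈ A, p' e :=
    Finset.prod_congr rfl fun e he => h e (Finset.mem_powerset.1 hA he)
  have h2 : ∏ e ∈ T \ A, (1 - p e) = ∏ e ∈ T \ A, (1 - p' e) :=
    Finset.prod_congr rfl fun e he => by rw [h e (Finset.mem_sdiff.1 he).1]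
  rw [h1, h2]

theorem percExp_const (p : E → ℝ) (T : Finset E) (c : ℝ) : percExp p T (fun _ => c) = c := by
  unfold percExp
  rw [← Finset.sum_mul, ← Finset.prod_add]
  simp

theorem percExp_const_mul (p : E → ℝ) (T : Finset E) (c : ℝ) (f : Finset E → ℝ) :
    percExp p T (fun A => c * f A) = c * percExp p T f := by
  unfold percExp
  rw [Finset.mul_sum]
  exact Finset.sum_congr rfl fun A _ => by ring

theorem percExp_sum (p : E → ℝ) (T : Finset E) {ι : Type*} (s : Finset ι)
    (f : ι → Finset E → ℝ) :
    percExp p T (fun A => ∑ i ∈ s, f i A) = ∑ i ∈ s, percExp p T (f i) := by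
  unfold percExp
  rw [Finset.sum_comm]
  exact Finset.sum_congr rfl fun A _ => Finset.mul_sum _ _ _

open Classical in
/-- The second moment of the likelihood ratio between the product laws with parameters `q` and
`p` factorizes over the edges, so Cauchy–Schwarz compares the two laws on every event. -/
theorem percExp_indicator_le_sqrt {p q : E → ℝ} {T : Finset E} {b : ℝ} (hb : 0 < b)
    (hp0 : ∀ e ∈ T, 0 < p e) (hp1 : ∀ e ∈ T, p e ≤ 1 - b) (P : Finset E → Prop) :
    percExp q T (fun A => if P A then 1 else 0) ≤
      Real.sqrt (Real.exp ((∑ e ∈ T, (p e - q e) ^ 2 / p e) / b)) *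
        Real.sqrt (percExp p T (fun A => if P A then 1 else 0)) := by
  set wp : Finset E → ℝ := fun A => (∏ e ∈ A, p e) * (∏ e ∈ T \ A, (1 - p e)) with hwp
  set wq : Finset E → ℝ := fun A => (∏ e ∈ A, q e) * (∏ e ∈ T \ A, (1 - q e)) with hwq
  have hpos : ∀ A ∈ T.powerset, 0 < wp A := fun A hA =>
    mul_pos (Finset.prod_pos fun e he => hp0 e (Finset.mem_powerset.1 hA he))
      (Finset.prod_pos fun e he => by linarith [hp1 e (Finset.mem_sdiff.1 he).1])
  have hsecond : ∑ A ∈ T.powerset, (wq A / √(wp A)) ^ 2 ≤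
      Real.exp ((∑ e ∈ T, (p e - q e) ^ 2 / p e) / b) := by
    calc ∑ A ∈ T.powerset, (wq A / √(wp A)) ^ 2
        = ∑ A ∈ T.powerset, (∏ e ∈ A, q e ^ 2 / p e) *
            ∏ e ∈ T \ A, (1 - q e) ^ 2 / (1 - p e) := by
          refine Finset.sum_congr rfl fun A hA => ?_
          rw [div_pow, Real.sq_sqrt (hpos A hA).le, hwp, hwq]
          simp only [Finset.prod_div_distrib, Finset.prod_pow]
          rw [mul_pow, mul_div_mul_comm]
      _ = ∏ e ∈ T, (q e ^ 2 / p e + (1 - q e) ^ 2 / (1 - p e)) := (Finset.prod_add _ _ _).symm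
      _ ≤ ∏ e ∈ T, Real.exp ((p e - q e) ^ 2 / p e / b) := by
          refine Finset.prod_le_prod (fun e he => ?_) fun e he => ?_
          · have h1 := hp0 e he
            have h2 : 0 < 1 - p e := by linarith [hp1 e he]
            positivity
          · have h1 := hp0 e he
            have h2 : 0 < 1 - p e := by linarith [hp1 e he]
            have h3 : b ≤ 1 - p e := by linarith [hp1 e he]
            have h4 : q e ^ 2 / p e + (1 - q e) ^ 2 / (1 - p e) =
                (p e - q e) ^ 2 / p e / (1 - p e) + 1 := by
              field_simp
              ring
            rw [h4]
            refine le_trans ?_ (Real.add_one_le_exp _)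
            gcongr
      _ = Real.exp ((∑ e ∈ T, (p e - q e) ^ 2 / p e) / b) := by
          rw [← Real.exp_sum, Finset.sum_div]
  have hfirst : percExp q T (fun A => if P A then 1 else 0) =
      ∑ A ∈ T.powerset, (wq A / √(wp A)) * (√(wp A) * if P A then 1 else 0) := by
    refine Finset.sum_congr rfl fun A hA => ?_
    have := (Real.sqrt_pos.2 (hpos A hA)).ne'
    rw [← mul_assoc, div_mul_cancel₀ _ this]
  have hlast : ∑ A ∈ T.powerset, (√(wp A) * if P A then (1 : ℝ) else 0) ^ 2 =
      percExp p T (fun A => if P A then 1 else 0) := by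
    refine Finset.sum_congr rfl fun A hA => ?_
    rw [mul_pow, Real.sq_sqrt (hpos A hA).le]
    by_cases h : P A <;> simp [hwp, h]
  rw [hfirst, ← hlast]
  refine (Real.sum_mul_le_sqrt_mul_sqrt _ _ _).trans ?_
  gcongr

end RandomSubset

/-! ### Exploration of a cluster edge by edge -/

section Exploration

variable {V : Type*} [DecidableEq V]

/-- The exploration principle. Suppose the functional `F S A` of a set `S` of found vertices and
a set `A` of present edges grows by at most the factor `y` when a present edge at `S` is removed
from `A` and its other end is added to `S`. If the potential `Φ` does not increase on average
when one edge at `S` is revealed, it bounds the expectation of `F`. -/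
theorem percExp_le_of_potential {p : Sym2 V → ℝ} (hp0 : ∀ e, 0 ≤ p e) (hp1 : ∀ e, p e ≤ 1)
    {F Φ : Finset V → Finset (Sym2 V) → ℝ} {y : ℝ} (hy : 0 ≤ y)
    (base : ∀ S T A, A ⊆ T → (∀ e ∈ T, ∀ s ∈ S, s ∉ e) → F S A ≤ Φ S T)
    (hF : ∀ S A s u, s ∈ S → s(s, u) ∉ A → F S (insert s(s, u) A) ≤ y * F (insert u S) A)
    (hΦ : ∀ S T s u, s ∈ S → s(s, u) ∉ T →
      (1 - p s(s, u)) * Φ S T + p s(s, u) * (y * Φ (insert u S) T) ≤ Φ S (insert s(s, u) T))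
    (T : Finset (Sym2 V)) (S : Finset V) : percExp p T (F S) ≤ Φ S T := by
  induction hn : T.card generalizing T S with
  | zero =>
    obtain rfl := Finset.card_eq_zero.1 hn
    simpa [percExp] using base S ∅ ∅ subset_rfl (by simp)
  | succ n ih =>
    by_cases h : ∃ e ∈ T, ∃ s ∈ S, s ∈ e
    · obtain ⟨e, he, s, hs, hse⟩ := h
      obtain ⟨u, rfl⟩ := Sym2.mem_iff_exists.1 hse
      obtain ⟨T', hT', rfl⟩ : ∃ T', s(s, u) ∉ T' ∧ insert s(s, u) T' = T :=
        ⟨T.erase s(s, u), Finset.notMem_erase _ _, Finset.insert_erase he⟩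
      rw [Finset.card_insert_of_notMem hT'] at hn
      have hn' : T'.card = n := by omega
      rw [percExp_insert p hT']
      refine le_trans ?_ (hΦ S T' s u hs hT')
      have h1 : percExp p T' (fun A => F S (insert s(s, u) A)) ≤
          y * percExp p T' (F (insert u S)) := by
        rw [← percExp_const_mul]
        exact percExp_mono (fun e _ => hp0 e) (fun e _ => hp1 e) fun A hA =>
          hF S A s u hs fun h => hT' (hA h)
      have h2 := ih T' S hn'
      have h3 := ih T' (insert u S) hn'
      have h4 : 0 ≤ 1 - p s(s, u) := sub_nonneg.2 (hp1 _)
      have h5 := hp0 s(s, u)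
      have h6 : percExp p T' (fun A => F S (insert s(s, u) A)) ≤ y * Φ (insert u S) T' :=
        h1.trans (by gcongr)
      gcongr
    · push Not at h
      calc percExp p T (F S) ≤ percExp p T (fun _ => Φ S T) :=
            percExp_mono (fun e _ => hp0 e) (fun e _ => hp1 e) fun A hA => base S T A hA h
        _ = Φ S T := percExp_const _ _ _

variable [Fintype V]

/-- The total of `b s` over the found vertices `s ∈ S`, plus that of `c s u` over the edges
`{s, u}` of `T` at the found vertices. -/
def edgePotential (b : V → ℝ) (c : V → V → ℝ) (S : Finset V) (T : Finset (Sym2 V)) : ℝ :=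
  ∑ s ∈ S, (b s + ∑ u ∈ Finset.univ.filter (fun u => s(s, u) ∈ T), c s u)

theorem edgePotential_insert_vertex {b : V → ℝ} {c : V → V → ℝ} (hb : ∀ v, 0 ≤ b v)
    (hc : ∀ v u, 0 ≤ c v u) (S : Finset V) (T : Finset (Sym2 V)) (u : V) :
    edgePotential b c (insert u S) T ≤ edgePotential b c S T + (b u + ∑ v, c u v) := by
  unfold edgePotential
  by_cases hu : u ∈ S
  · rw [Finset.insert_eq_of_mem hu]
    have := Finset.sum_nonneg fun v (_ : v ∈ Finset.univ) => hc u v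
    linarith [hb u]
  · rw [Finset.sum_insert hu, add_comm]
    gcongr
    · exact fun i _ _ => hc u i
    · exact Finset.subset_univ _

theorem edgePotential_insert_edge {b : V → ℝ} {c : V → V → ℝ}
    (hc : ∀ v u, 0 ≤ c v u) {S : Finset V} {T : Finset (Sym2 V)} {s u : V} (hs : s ∈ S)
    (he : s(s, u) ∉ T) :
    edgePotential b c S T + c s u ≤ edgePotential b c S (insert s(s, u) T) := by
  unfold edgePotential
  rw [← Finset.add_sum_erase _ _ hs, ← Finset.add_sum_erase _ (fun s' => b s' + _) hs]
  have h1 : ∑ v ∈ Finset.univ.filter (fun v => s(s, v) ∈ T), c s v + c s u ≤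
      ∑ v ∈ Finset.univ.filter (fun v => s(s, v) ∈ insert s(s, u) T), c s v := by
    rw [add_comm, ← Finset.sum_insert (f := c s) (by simpa using he)]
    refine Finset.sum_le_sum_of_subset_of_nonneg (fun v hv => ?_) fun v _ _ => hc s v
    simp only [Finset.mem_insert, Finset.mem_filter, Finset.mem_univ, true_and] at hv ⊢
    rcases hv with rfl | h
    · exact Or.inl rfl
    · exact Or.inr h
  have h2 : ∑ x ∈ S.erase s, (b x + ∑ v ∈ Finset.univ.filter (fun v => s(x, v) ∈ T), c x v) ≤
      ∑ x ∈ S.erase s,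
        (b x + ∑ v ∈ Finset.univ.filter (fun v => s(x, v) ∈ insert s(s, u) T), c x v) := by
    refine Finset.sum_le_sum fun x _ => ?_
    gcongr
    · exact fun i _ _ => hc x i
    · exact Finset.subset_insert _ _
  linarith

theorem edgePotential_of_no_edge (b : V → ℝ) (c : V → V → ℝ) {S : Finset V}
    {T : Finset (Sym2 V)} (h : ∀ e ∈ T, ∀ s ∈ S, s ∉ e) :
    edgePotential b c S T = ∑ s ∈ S, b s := by
  unfold edgePotential
  refine Finset.sum_congr rfl fun s hs => ?_
  rw [Finset.filter_false_of_mem fun u _ hu => h _ hu s hs (Sym2.mem_mk_left s u)]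
  simp

theorem edgePotential_singleton_le {b : V → ℝ} {c : V → V → ℝ} (hc : ∀ v u, 0 ≤ c v u)
    (k : V) (T : Finset (Sym2 V)) : edgePotential b c {k} T ≤ b k + ∑ u, c k u := by
  unfold edgePotential
  rw [Finset.sum_singleton]
  gcongr
  · exact fun i _ _ => hc k i
  · exact Finset.subset_univ _

/-- The vertices that can be reached from `S` along edges in `A`. -/
def cluster {V : Type*} (S : Finset V) (A : Finset (Sym2 V)) : Set V :=
  {v | ∃ s ∈ S, Relation.ReflTransGen (fun a b => s(a, b) ∈ A) s v}

theorem subset_cluster {V : Type*} (S : Finset V) (A : Finset (Sym2 V)) {s : V} (hs : s ∈ S) :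
    s ∈ cluster S A := ⟨s, hs, Relation.ReflTransGen.refl⟩

theorem cluster_tail {V : Type*} {S : Finset V} {A : Finset (Sym2 V)} {v w : V}
    (hv : v ∈ cluster S A) (h : s(v, w) ∈ A) : w ∈ cluster S A := by
  obtain ⟨s, hs, hsv⟩ := hv
  exact ⟨s, hs, hsv.tail h⟩

theorem cluster_insert_subset {V : Type*} [DecidableEq V] {S : Finset V} {A : Finset (Sym2 V)}
    {s u : V} (hs : s ∈ S) : cluster S (insert s(s, u) A) ⊆ cluster (insert u S) A := by
  rintro v ⟨r, hr, hrv⟩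
  induction hrv with
  | refl => exact subset_cluster _ _ (Finset.mem_insert_of_mem hr)
  | tail _ h ih =>
    rename_i a b _
    rcases Finset.mem_insert.1 h with h | h
    · rcases Sym2.eq_iff.1 h with ⟨-, rfl⟩ | ⟨-, rfl⟩
      · exact subset_cluster _ _ (Finset.mem_insert_self _ _)
      · exact subset_cluster _ _ (Finset.mem_insert_of_mem hs)
    · exact cluster_tail ih h

theorem cluster_eq_of_no_edge {V : Type*} {S : Finset V} {A : Finset (Sym2 V)}
    (h : ∀ e ∈ A, ∀ s ∈ S, s ∉ e) {v : V} (hv : v ∈ cluster S A) : v ∈ S := by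
  obtain ⟨s, hs, hsv⟩ := hv
  induction hsv with
  | refl => exact hs
  | tail _ hab ih => exact absurd (Sym2.mem_mk_left _ _) (h _ hab _ ih)

open Classical in
/-- First moment bound on the probability that `k` is connected to `j`: the function `h` is a
superharmonic majorant of the expected number of paths to `j`. -/
theorem percExp_connected_le {p : Sym2 V → ℝ} (hp0 : ∀ e, 0 ≤ p e) (hp1 : ∀ e, p e ≤ 1)
    {j k : V} (hjk : k ≠ j) {h : V → ℝ} (hh0 : ∀ v, 0 ≤ h v)
    (hh : ∀ v, ∑ u, p s(v, u) * ((if u = j then 1 else 0) + h u) ≤ h v)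
    (T : Finset (Sym2 V)) :
    percExp p T (fun A => if j ∈ cluster {k} A then 1 else 0) ≤ h k := by
  set b : V → ℝ := fun u => if u = j then 1 else 0 with hb
  have hb0 : ∀ v, 0 ≤ b v := fun v => by simp only [hb]; split_ifs <;> norm_num
  set c : V → V → ℝ := fun v u => p s(v, u) * (b u + h u) with hc
  have hc0 : ∀ v u, 0 ≤ c v u := fun v u => mul_nonneg (hp0 _) (add_nonneg (hb0 u) (hh0 u))
  have key := percExp_le_of_potential hp0 hp1
    (F := fun S A => if j ∈ cluster S A then 1 else 0) (Φ := edgePotential b c) (y := 1)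
    zero_le_one ?_ ?_ ?_ T {k}
  · refine key.trans ((edgePotential_singleton_le hc0 k T).trans ?_)
    have : b k = 0 := by simp [hb, hjk]
    rw [this, zero_add]
    exact hh k
  · intro S T A hAT hT
    rw [edgePotential_of_no_edge b c hT]
    split_ifs with hj
    · have hjS := cluster_eq_of_no_edge (fun e he => hT e (hAT he)) hj
      calc (1 : ℝ) = b j := by simp [hb]
        _ ≤ _ := Finset.single_le_sum (fun v _ => hb0 v) hjS
    · exact Finset.sum_nonneg fun v _ => hb0 v
  · intro S A s u hs _
    rw [one_mul]
    by_cases hj : j ∈ cluster S (insert s(s, u) A)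
    · simp [hj, cluster_insert_subset hs hj]
    · simp only [hj, if_false]
      split_ifs <;> norm_num
  · intro S T s u hs he
    have h1 := edgePotential_insert_vertex hb0 hc0 S T u
    have h2 := edgePotential_insert_edge (b := b) hc0 hs he
    have h3 := hh u
    have h4 : edgePotential b c (insert u S) T ≤ edgePotential b c S T + (b u + h u) := by
      linarith
    have h5 := mul_le_mul_of_nonneg_left h4 (hp0 s(s, u))
    have h6 : c s u = p s(s, u) * (b u + h u) := rfl
    linarith

open Classical in
/-- The number of edges in `A` with an end in the cluster of `S`. -/
noncomputable def clusterEdges {V : Type*} (S : Finset V) (A : Finset (Sym2 V)) : ℕ :=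
  (A.filter fun e => ∃ v ∈ e, v ∈ cluster S A).card

theorem clusterEdges_insert_le {V : Type*} [DecidableEq V] {S : Finset V} {A : Finset (Sym2 V)}
    {s u : V} (hs : s ∈ S) :
    clusterEdges S (insert s(s, u) A) ≤ clusterEdges (insert u S) A + 1 := by
  classical
  unfold clusterEdges
  refine le_trans (Finset.card_le_card ?_) (Finset.card_insert_le s(s, u) _)
  intro e he
  simp only [Finset.mem_filter, Finset.mem_insert] at he ⊢
  rcases he with ⟨rfl | he, v, hv, hvc⟩
  · exact Or.inl rfl
  · exact Or.inr ⟨he, v, hv, cluster_insert_subset hs hvc⟩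

theorem clusterEdges_of_no_edge {V : Type*} {S : Finset V} {A : Finset (Sym2 V)}
    (h : ∀ e ∈ A, ∀ s ∈ S, s ∉ e) : clusterEdges S A = 0 := by
  classical
  unfold clusterEdges
  rw [Finset.card_eq_zero, Finset.filter_false_of_mem]
  rintro e he ⟨v, hv, hvc⟩
  exact h e he v (cluster_eq_of_no_edge h hvc) hv

/-- Exponential moment of the number of edges of a cluster: `a` is a supersolution of the
recursion for the logarithmic moment generating function of the dominating branching process. -/
theorem percExp_exp_clusterEdges_le {p : Sym2 V → ℝ} (hp0 : ∀ e, 0 ≤ p e) (hp1 : ∀ e, p e ≤ 1)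
    {θ : ℝ} (hθ : 0 ≤ θ) {a : V → ℝ} (ha0 : ∀ v, 0 ≤ a v)
    (ha : ∀ v, ∑ u, p s(v, u) * (Real.exp (θ + a u) - 1) ≤ a v)
    (T : Finset (Sym2 V)) (k : V) :
    percExp p T (fun A => Real.exp (θ * clusterEdges {k} A)) ≤ Real.exp (a k) := by
  set c : V → V → ℝ := fun v u => p s(v, u) * (Real.exp (θ + a u) - 1) with hc
  have hc0 : ∀ v u, 0 ≤ c v u := fun v u =>
    mul_nonneg (hp0 _) (sub_nonneg.2 (Real.one_le_exp (add_nonneg hθ (ha0 u))))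
  have key := percExp_le_of_potential hp0 hp1
    (F := fun S A => Real.exp (θ * clusterEdges S A))
    (Φ := fun S T => Real.exp (edgePotential 0 c S T)) (y := Real.exp θ)
    (Real.exp_pos θ).le ?_ ?_ ?_ T {k}
  · refine key.trans (Real.exp_le_exp.2 ((edgePotential_singleton_le hc0 k T).trans ?_))
    simpa using ha k
  · intro S T A hAT hT
    simp only [clusterEdges_of_no_edge fun e he => hT e (hAT he), edgePotential_of_no_edge 0 c hT]
    simp
  · intro S A s u hs _
    rw [← Real.exp_add, Real.exp_le_exp]
    have : (clusterEdges S (insert s(s, u) A) : ℝ) ≤ clusterEdges (insert u S) A + 1 := by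
      exact_mod_cast clusterEdges_insert_le hs
    nlinarith
  · intro S T s u hs he
    have h1 := edgePotential_insert_vertex (b := 0) (fun _ => le_rfl) hc0 S T u
    have h2 := edgePotential_insert_edge (b := 0) hc0 hs he
    have h4 : edgePotential 0 c (insert u S) T ≤ edgePotential 0 c S T + a u := by
      have := ha u
      simp only [Pi.zero_apply, zero_add] at h1
      linarith
    have h5 : Real.exp θ * Real.exp (edgePotential 0 c (insert u S) T) ≤
        Real.exp (edgePotential 0 c S T) * Real.exp (θ + a u) := by
      rw [← Real.exp_add, ← Real.exp_add]
      exact Real.exp_le_exp.2 (by linarith)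
    calc _ ≤ (1 - p s(s, u)) * Real.exp (edgePotential 0 c S T) + p s(s, u) *
          (Real.exp (edgePotential 0 c S T) * Real.exp (θ + a u)) := by
          gcongr
          exact hp0 _
      _ = Real.exp (edgePotential 0 c S T) * (c s u + 1) := by simp only [hc]; ring
      _ ≤ Real.exp (edgePotential 0 c S T) * Real.exp (c s u) := by
          gcongr
          exact Real.add_one_le_exp _
      _ = Real.exp (edgePotential 0 c S T + c s u) := (Real.exp_add _ _).symm
      _ ≤ _ := Real.exp_le_exp.2 h2

open Classical in
/-- The exponential moment bound inside a set `W` of vertices: only the vertices of `W` enter the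
recursion. -/
theorem percExp_exp_clusterEdges_le_of_subset {p : Sym2 V → ℝ} (hp0 : ∀ e, 0 ≤ p e)
    (hp1 : ∀ e, p e ≤ 1) {θ : ℝ} (hθ : 0 ≤ θ) {a : V → ℝ} (ha0 : ∀ v, 0 ≤ a v) (W : Set V)
    (ha : ∀ v, ∑ u with u ∈ W, p s(v, u) * (Real.exp (θ + a u) - 1) ≤ a v)
    {T : Finset (Sym2 V)} (hT : ∀ e ∈ T, ∀ v ∈ e, v ∈ W) (k : V) :
    percExp p T (fun A => Real.exp (θ * clusterEdges {k} A)) ≤ Real.exp (a k) := by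
  rw [percExp_congr (p' := fun e => if ∀ v ∈ e, v ∈ W then p e else 0)
    fun e he => (if_pos (hT e he)).symm]
  refine percExp_exp_clusterEdges_le (fun e => ?_) (fun e => ?_) hθ ha0 (fun v => ?_) T k
  · split_ifs
    exacts [hp0 e, le_rfl]
  · split_ifs
    exacts [hp1 e, zero_le_one]
  · refine le_trans ?_ (ha v)
    rw [Finset.sum_filter]
    refine Finset.sum_le_sum fun u _ => ?_
    have h1 : 0 ≤ Real.exp (θ + a u) - 1 :=
      sub_nonneg.2 (Real.one_le_exp (add_nonneg hθ (ha0 u)))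
    have h2 := mul_nonneg (hp0 s(v, u)) h1
    by_cases hu : u ∈ W
    · rw [if_pos hu]
      split_ifs
      · exact le_rfl
      · simpa using h2
    · rw [if_neg hu, if_neg fun h => hu (h u (Sym2.mem_mk_right v u)), zero_mul]

end Exploration

/-! ### The law of the random graph and contiguity -/

open Classical in
/-- The edges of `G` that lie in `T`. -/
noncomputable def edgesIn {V : Type*} (G : SimpleGraph V) (T : Finset (Sym2 V)) :
    Finset (Sym2 V) :=
  {e ∈ T | e ∈ G.edgeSet}

theorem edgesIn_subset {V : Type*} (G : SimpleGraph V) (T : Finset (Sym2 V)) :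
    edgesIn G T ⊆ T := by
  classical exact Finset.filter_subset _ _

theorem mem_edgesIn {V : Type*} {G : SimpleGraph V} {T : Finset (Sym2 V)} {e : Sym2 V} :
    e ∈ edgesIn G T ↔ e ∈ T ∧ e ∈ G.edgeSet := by
  classical exact Finset.mem_filter

variable {N : ℕ}

theorem HasIndepEdges.measure_edgesIn_eq_le {Ω : Type*} [MeasurableSpace Ω] {μ : Measure Ω}
    [IsProbabilityMeasure μ] {G : Ω → SimpleGraph (Vtx N)} {q : Vtx N → Vtx N → ℝ}
    (h : HasIndepEdges μ G q) (hsym : ∀ i j, q i j = q j i)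
    (hq0 : ∀ i j, i ≠ j → 0 ≤ q i j) (hq1 : ∀ i j, i ≠ j → q i j ≤ 1)
    {T : Finset (Sym2 (Vtx N))} (hT : ∀ e ∈ T, ¬ e.IsDiag) {A : Finset (Sym2 (Vtx N))}
    (hA : A ⊆ T) :
    μ {ω | edgesIn (G ω) T = A} ≤ ENNReal.ofReal
      ((∏ e ∈ A, Sym2.lift ⟨q, hsym⟩ e) * ∏ e ∈ T \ A, (1 - Sym2.lift ⟨q, hsym⟩ e)) := by
  classical
  let I := {e : Vtx N × Vtx N // e.1 < e.2}
  let m : I → Sym2 (Vtx N) := fun i => s(i.1.1, i.1.2)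
  have hm : Function.Injective m := by
    rintro ⟨⟨a, b⟩, hab⟩ ⟨⟨c, d⟩, hcd⟩ hi
    rcases Sym2.eq_iff.1 hi with ⟨h1, h2⟩ | ⟨h1, h2⟩
    · simp only at h1 h2
      subst h1 h2
      rfl
    · simp only at h1 h2 hab hcd
      subst h1 h2
      exact absurd hab hcd.asymm
  let Ed : I → Set Ω := fun i => {ω | (G ω).Adj i.1.1 i.1.2}
  let s : I → Set Ω := fun i =>
    if m i ∈ A then Ed i else if m i ∈ T then (Ed i)ᶜ else Set.univ
  let g : Sym2 (Vtx N) → ℝ := fun e =>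
    if e ∈ A then Sym2.lift ⟨q, hsym⟩ e else if e ∈ T then 1 - Sym2.lift ⟨q, hsym⟩ e else 1
  have hsub : {ω | edgesIn (G ω) T = A} ⊆ ⋂ i, s i := by
    intro ω hω
    change edgesIn (G ω) T = A at hω
    refine Set.mem_iInter.2 fun i => ?_
    simp only [s]
    split_ifs with h1 h2
    · rw [← hω] at h1
      exact (mem_edgesIn.1 h1).2
    · exact fun hE => h1 (hω ▸ mem_edgesIn.2 ⟨h2, hE⟩)
    · trivial
  have hmeas : ∀ i, MeasurableSet[MeasurableSpace.generateFrom {Ed i}] (s i) := by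
    intro i
    have hE : MeasurableSet[MeasurableSpace.generateFrom {Ed i}] (Ed i) :=
      MeasurableSpace.measurableSet_generateFrom rfl
    simp only [s]
    split_ifs
    · exact hE
    · exact hE.compl
    · exact MeasurableSet.univ
  have hind : μ (⋂ i, s i) = ∏ i, μ (s i) := iIndep.meas_iInter h.indep_edge hmeas
  have hne : ∀ i : I, i.1.1 ≠ i.1.2 := fun i => i.2.ne
  have hg : ∀ i, μ (s i) = ENNReal.ofReal (g (m i)) := by
    intro i
    simp only [s, g]
    split_ifs
    · exact h.prob_edge _ _ i.2
    · have h3 : Sym2.lift ⟨q, hsym⟩ (m i) = q i.1.1 i.1.2 := rfl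
      rw [prob_compl_eq_one_sub (h.measurable_edge _ _ i.2), h.prob_edge _ _ i.2, h3,
        ENNReal.ofReal_sub _ (hq0 _ _ (hne i)), ENNReal.ofReal_one]
    · simp
  have hg0 : ∀ i, 0 ≤ g (m i) := by
    intro i
    simp only [g]
    split_ifs
    · exact hq0 _ _ (hne i)
    · exact sub_nonneg.2 (hq1 _ _ (hne i))
    · exact zero_le_one
  refine (measure_mono hsub).trans_eq ?_
  rw [hind, Finset.prod_congr rfl fun i _ => hg i,
    ← ENNReal.ofReal_prod_of_nonneg fun i _ => hg0 i]
  congr 1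
  calc ∏ i, g (m i) = ∏ e ∈ Finset.univ.image m, g e :=
        (Finset.prod_image fun a _ b _ hab => hm hab).symm
    _ = ∏ e ∈ T, g e := by
        refine (Finset.prod_subset (fun e he => ?_) fun e _ he => ?_).symm
        · induction e with
          | _ a b =>
            have hab : a ≠ b := fun h => hT _ he (Sym2.mk_isDiag_iff.2 h)
            rcases lt_or_gt_of_ne hab with hlt | hlt
            · exact Finset.mem_image.2 ⟨⟨(a, b), hlt⟩, Finset.mem_univ _, rfl⟩
            · exact Finset.mem_image.2 ⟨⟨(b, a), hlt⟩, Finset.mem_univ _, Sym2.eq_swap⟩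
        · simp only [g, if_neg he, if_neg fun h => he (hA h)]
    _ = _ := by
        rw [← Finset.prod_sdiff hA, mul_comm]
        congr 1
        · exact Finset.prod_congr rfl fun e he => if_pos he
        · refine Finset.prod_congr rfl fun e he => ?_
          rw [Finset.mem_sdiff] at he
          simp only [g, if_neg he.2, if_pos he.1]

open Classical in
theorem HasIndepEdges.measure_le {Ω : Type*} [MeasurableSpace Ω] {μ : Measure Ω}
    [IsProbabilityMeasure μ] {G : Ω → SimpleGraph (Vtx N)} {q : Vtx N → Vtx N → ℝ}
    (h : HasIndepEdges μ G q) (hsym : ∀ i j, q i j = q j i)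
    (hq0 : ∀ i j, i ≠ j → 0 ≤ q i j) (hq1 : ∀ i j, i ≠ j → q i j ≤ 1)
    {T : Finset (Sym2 (Vtx N))} (hT : ∀ e ∈ T, ¬ e.IsDiag)
    (P : Finset (Sym2 (Vtx N)) → Prop) :
    μ {ω | P (edgesIn (G ω) T)} ≤ ENNReal.ofReal
      (percExp (Sym2.lift ⟨q, hsym⟩) T (fun A => if P A then 1 else 0)) := by
  have hlift0 : ∀ e ∈ T, 0 ≤ Sym2.lift ⟨q, hsym⟩ e := fun e he => by
    induction e with
    | _ a b => exact hq0 a b fun h => hT _ he (Sym2.mk_isDiag_iff.2 h)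
  have hlift1 : ∀ e ∈ T, Sym2.lift ⟨q, hsym⟩ e ≤ 1 := fun e he => by
    induction e with
    | _ a b => exact hq1 a b fun h => hT _ he (Sym2.mk_isDiag_iff.2 h)
  calc μ {ω | P (edgesIn (G ω) T)}
      ≤ μ (⋃ A ∈ T.powerset.filter P, {ω | edgesIn (G ω) T = A}) := by
        refine measure_mono fun ω hω => ?_
        simp only [Set.mem_iUnion]
        exact ⟨edgesIn (G ω) T, Finset.mem_filter.2
          ⟨Finset.mem_powerset.2 (edgesIn_subset _ _), hω⟩, rfl⟩
    _ ≤ ∑ A ∈ T.powerset.filter P, μ {ω | edgesIn (G ω) T = A} :=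
        measure_biUnion_finset_le _ _
    _ ≤ ∑ A ∈ T.powerset.filter P, ENNReal.ofReal ((∏ e ∈ A, Sym2.lift ⟨q, hsym⟩ e) *
          ∏ e ∈ T \ A, (1 - Sym2.lift ⟨q, hsym⟩ e)) :=
        Finset.sum_le_sum fun A hA => h.measure_edgesIn_eq_le hsym hq0 hq1 hT
          (Finset.mem_powerset.1 (Finset.mem_filter.1 hA).1)
    _ = _ := by
        rw [← ENNReal.ofReal_sum_of_nonneg fun A hA =>
          percExp_weight_nonneg hlift0 hlift1 (Finset.mem_filter.1 hA).1, Finset.sum_filter]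
        congr 1
        refine Finset.sum_congr rfl fun A _ => ?_
        by_cases hPA : P A <;> simp [hPA]

theorem clProb_comm (β γ : ℝ) (i j : Vtx N) : clProb β γ N i j = clProb β γ N j i := by
  unfold clProb
  rw [mul_comm ((i.1 : ℝ) ^ γ)]

/-- The Chung–Lu connection probabilities as a function of the unordered pair. -/
noncomputable def clEdgeProb (β γ : ℝ) (N : ℕ) : Sym2 (Vtx N) → ℝ :=
  Sym2.lift ⟨clProb β γ N, clProb_comm β γ⟩

theorem Vtx.one_le (i : Vtx N) : (1 : ℝ) ≤ i.1 := by
  exact_mod_cast (Finset.mem_Icc.1 i.2).1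

theorem Vtx.le_N (i : Vtx N) : (i.1 : ℝ) ≤ N := by
  exact_mod_cast (Finset.mem_Icc.1 i.2).2

theorem Vtx.pos (i : Vtx N) : (0 : ℝ) < i.1 := zero_lt_one.trans_le i.one_le

theorem Vtx.one_le_N (i : Vtx N) : (1 : ℝ) ≤ N := i.one_le.trans i.le_N

theorem clProb_pos {β γ : ℝ} (hβ : 0 < β) (i j : Vtx N) : 0 < clProb β γ N i j := by
  have h1 := i.pos
  have h2 := j.pos
  have h3 : (0 : ℝ) < N := zero_lt_one.trans_le i.one_le_N
  unfold clProb
  positivity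

theorem clProb_le {β γ : ℝ} (hβ : 0 < β) (hγ : 0 < γ) (hγ2 : 2 * γ < 1) (i j : Vtx N) :
    clProb β γ N i j ≤ β := by
  refine (min_le_left _ _).trans ?_
  have h1 : 1 ≤ (i.1 : ℝ) ^ γ := Real.one_le_rpow i.one_le hγ.le
  have h2 : 1 ≤ (j.1 : ℝ) ^ γ := Real.one_le_rpow j.one_le hγ.le
  have h3 : (N : ℝ) ^ (2 * γ - 1) ≤ 1 :=
    Real.rpow_le_one_of_one_le_of_nonpos i.one_le_N (by linarith)
  have h4 : 1 ≤ (i.1 : ℝ) ^ γ * (j.1 : ℝ) ^ γ := one_le_mul_of_one_le_of_one_le h1 h2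
  rw [div_le_iff₀ (by linarith)]
  exact mul_le_mul_of_nonneg_left (h3.trans h4) hβ.le

theorem clEdgeProb_pos {β γ : ℝ} (hβ : 0 < β) (e : Sym2 (Vtx N)) : 0 < clEdgeProb β γ N e := by
  induction e with
  | _ a b => exact clProb_pos hβ a b

theorem clEdgeProb_le {β γ : ℝ} (hβ : 0 < β) (hγ : 0 < γ) (hγ2 : 2 * γ < 1)
    (e : Sym2 (Vtx N)) : clEdgeProb β γ N e ≤ β := by
  induction e with
  | _ a b => exact clProb_le hβ hγ hγ2 a b

open Classical in
/-- Contiguity: for large `N`, the probability of an event for a graph of the class is at most a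
constant times the square root of its probability for the Chung–Lu graph. -/
theorem InClass.exists_measure_le_sqrt {β γ : ℝ} (hβ : 0 < β) (hγ : 0 < γ)
    (hβγ : β + 2 * γ < 1) {Ω : ℕ → Type*} [∀ N, MeasurableSpace (Ω N)]
    {μ : ∀ N, Measure (Ω N)} [∀ N, IsProbabilityMeasure (μ N)]
    {G : ∀ N, Ω N → SimpleGraph (Vtx N)} (hG : InClass β γ μ G) :
    ∃ C : ℝ, 0 < C ∧ ∀ᶠ N in atTop, ∀ T : Finset (Sym2 (Vtx N)), (∀ e ∈ T, ¬ e.IsDiag) →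
      ∀ P : Finset (Sym2 (Vtx N)) → Prop, μ N {ω | P (edgesIn (G N ω) T)} ≤ ENNReal.ofReal
        (C * √(percExp (clEdgeProb β γ N) T (fun A => if P A then 1 else 0))) := by
  obtain ⟨q, hsym, hq, hind, hlim⟩ := hG
  refine ⟨√(Real.exp (1 / (1 - β))), Real.sqrt_pos.2 (Real.exp_pos _), ?_⟩
  filter_upwards [hlim.eventually (gt_mem_nhds zero_lt_one)] with N hN T hT P
  have hb : 0 < 1 - β := by linarith
  refine ((hind N).measure_le (hsym N) (fun i j hij => (hq N i j hij).1.le)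
    (fun i j hij => by linarith [(hq N i j hij).2]) hT P).trans (ENNReal.ofReal_le_ofReal ?_)
  refine (percExp_indicator_le_sqrt hb (fun e _ => clEdgeProb_pos (γ := γ) hβ e)
    (fun e _ => ?_) P).trans ?_
  · linarith [clEdgeProb_le hβ hγ (by linarith) e]
  · gcongr
    refine le_trans ?_ hN.le
    set F : Vtx N × Vtx N → ℝ := fun e =>
      (clProb β γ N e.1 e.2 - q N e.1 e.2) ^ 2 / clProb β γ N e.1 e.2 with hF
    have hF0 : ∀ e, 0 ≤ F e := fun e => div_nonneg (sq_nonneg _) (clProb_pos hβ _ _).le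
    have hout : ∀ e : Sym2 (Vtx N), s((Quot.out e).1, (Quot.out e).2) = e := fun e =>
      Quot.out_eq e
    calc ∑ e ∈ T, (clEdgeProb β γ N e - Sym2.lift ⟨q N, hsym N⟩ e) ^ 2 / clEdgeProb β γ N e
        = ∑ e ∈ T, F (Quot.out e) := by
          refine Finset.sum_congr rfl fun e _ => ?_
          conv_lhs => rw [← hout e]
          rfl
      _ = ∑ x ∈ T.image Quot.out, F x := by
          rw [Finset.sum_image]
          intro a _ b _ hab
          rw [← hout a, ← hout b]
          rw [hab]
      _ ≤ ∑ x ∈ (Finset.univ : Finset (Vtx N)).offDiag, F x := by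
          refine Finset.sum_le_sum_of_subset_of_nonneg (fun x hx => ?_) fun x _ _ => hF0 x
          obtain ⟨e, he, rfl⟩ := Finset.mem_image.1 hx
          simp only [Finset.mem_offDiag, Finset.mem_univ, true_and]
          intro h
          refine hT e he ?_
          rw [← hout e]
          exact Sym2.mk_isDiag_iff.2 h

/-! ### Components and clusters -/

open Classical in
/-- The unordered pairs of distinct vertices of `W`. -/
noncomputable def pairsIn {V : Type*} [Fintype V] (W : Set V) : Finset (Sym2 V) :=
  {e | ¬ e.IsDiag ∧ ∀ v ∈ e, v ∈ W}

theorem mem_pairsIn {V : Type*} [Fintype V] {W : Set V} {e : Sym2 V} :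
    e ∈ pairsIn W ↔ ¬ e.IsDiag ∧ ∀ v ∈ e, v ∈ W := by
  classical simp [pairsIn]

theorem mem_cluster_of_reachable {V : Type*} [Fintype V] {G : SimpleGraph V} {k v : V}
    {W : Set V} (hW : ∀ w, G.Reachable k w → w ∈ W) (h : G.Reachable k v) :
    v ∈ cluster {k} (edgesIn G (pairsIn W)) := by
  have h' := SimpleGraph.reachable_iff_reflTransGen k v |>.1 h
  induction h' with
  | refl => exact subset_cluster _ _ (Finset.mem_singleton_self k)
  | tail hab hbc ih =>
    rename_i b c
    have hb : G.Reachable k b := (SimpleGraph.reachable_iff_reflTransGen k b).2 hab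
    have hc : G.Reachable k c := hb.trans hbc.reachable
    refine cluster_tail (ih hb) (mem_edgesIn.2 ⟨mem_pairsIn.2 ⟨?_, ?_⟩, hbc⟩)
    · exact fun h => hbc.ne (Sym2.mk_isDiag_iff.1 h)
    · intro w hw
      rcases Sym2.mem_iff.1 hw with rfl | rfl
      exacts [hW _ hb, hW _ hc]

/-- The total degree of a component is at most twice its number of edges. -/
theorem totalDegree_le_clusterEdges {G : SimpleGraph (Vtx N)} {k : Vtx N} {W : Set (Vtx N)}
    (hW : ∀ w, G.Reachable k w → w ∈ W) :
    totalDegree G k ≤ 2 * clusterEdges {k} (edgesIn G (pairsIn W)) := by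
  classical
  set C := (G.connectedComponentMk k).supp.toFinset with hC
  have hmem : ∀ v ∈ C, G.Reachable k v := fun v hv => by
    simp only [hC, Set.mem_toFinset, SimpleGraph.ConnectedComponent.mem_supp_iff,
      SimpleGraph.ConnectedComponent.eq] at hv
    exact hv.symm
  set E := (edgesIn G (pairsIn W)).filter
    (fun e => ∃ v ∈ e, v ∈ cluster {k} (edgesIn G (pairsIn W))) with hE
  have hdeg : ∀ v ∈ C, G.degree v ≤ (E.filter (v ∈ ·)).card := by
    intro v hv
    rw [← SimpleGraph.card_incidenceFinset_eq_degree]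
    refine Finset.card_le_card fun e he => ?_
    have he' : e ∈ G.edgeSet ∧ v ∈ e := by
      simpa [SimpleGraph.mem_incidenceFinset, SimpleGraph.incidenceSet] using he
    refine Finset.mem_filter.2 ⟨Finset.mem_filter.2 ⟨mem_edgesIn.2 ⟨mem_pairsIn.2
      ⟨G.not_isDiag_of_mem_edgeSet he'.1, fun w hw => hW w ?_⟩, he'.1⟩, v, he'.2,
      mem_cluster_of_reachable hW (hmem v hv)⟩, he'.2⟩
    obtain ⟨u, rfl⟩ := Sym2.mem_iff_exists.1 he'.2
    rcases Sym2.mem_iff.1 hw with rfl | rfl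
    · exact hmem _ hv
    · exact (hmem v hv).trans (SimpleGraph.Adj.reachable he'.1)
  calc totalDegree G k = ∑ v ∈ C, G.degree v := by
        unfold totalDegree
        congr!
    _ ≤ ∑ v ∈ C, (E.filter (v ∈ ·)).card := Finset.sum_le_sum hdeg
    _ = ∑ e ∈ E, (C.filter (· ∈ e)).card :=
        Finset.sum_card_bipartiteAbove_eq_sum_card_bipartiteBelow (fun v e => v ∈ e)
    _ ≤ ∑ e ∈ E, 2 := by
        refine Finset.sum_le_sum fun e _ => ?_
        calc (C.filter (· ∈ e)).card ≤ e.toFinset.card :=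
              Finset.card_le_card fun v hv => Sym2.mem_toFinset.2 (Finset.mem_filter.1 hv).2
          _ ≤ 2 := by rw [Sym2.card_toFinset]; split_ifs <;> norm_num
    _ = 2 * clusterEdges {k} (edgesIn G (pairsIn W)) := by
        rw [Finset.sum_const, smul_eq_mul, mul_comm, clusterEdges, hE]
        congr!

/-! ### Vertex weights -/

/-- The weight `(N / i) ^ γ` of the vertex `i`. -/
noncomputable def weight (γ : ℝ) (i : Vtx N) : ℝ := ((N : ℝ) / i.1) ^ γ

theorem one_le_weight {γ : ℝ} (hγ : 0 < γ) (i : Vtx N) : 1 ≤ weight γ i :=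
  Real.one_le_rpow ((one_le_div i.pos).2 i.le_N) hγ.le

theorem clProb_le_weight {β γ : ℝ} (i j : Vtx N) :
    clProb β γ N i j ≤ β / N * weight γ i * weight γ j := by
  refine (min_le_left _ _).trans_eq ?_
  have hN : (0 : ℝ) < N := zero_lt_one.trans_le i.one_le_N
  have hi := Real.rpow_pos_of_pos i.pos γ
  have hj := Real.rpow_pos_of_pos j.pos γ
  unfold weight
  rw [Real.div_rpow hN.le i.pos.le, Real.div_rpow hN.le j.pos.le,
    show 2 * γ - 1 = γ + γ - 1 by ring, Real.rpow_sub hN, Real.rpow_add hN, Real.rpow_one]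
  field_simp

theorem sum_rpow_neg_le {a : ℝ} (ha0 : 0 ≤ a) (ha1 : a < 1) (n : ℕ) :
    ∑ i ∈ Finset.Icc 1 n, (i : ℝ) ^ (-a) ≤ (n : ℝ) ^ (1 - a) / (1 - a) := by
  have h1a : 0 < 1 - a := by linarith
  induction n with
  | zero => simp [Real.zero_rpow h1a.ne']
  | succ n ih =>
    rw [Finset.sum_Icc_succ_top (by omega)]
    have hn : (0 : ℝ) < (n + 1 : ℕ) := by positivity
    -- Bernoulli's inequality for the exponent `1 - a`
    have hb : (1 + -(1 / ((n + 1 : ℕ) : ℝ))) ^ (1 - a) ≤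
        1 + (1 - a) * -(1 / ((n + 1 : ℕ) : ℝ)) := by
      refine rpow_one_add_le_one_add_mul_self ?_ h1a.le (by linarith)
      rw [neg_le_neg_iff, div_le_one hn]
      push_cast
      linarith [Nat.cast_nonneg (α := ℝ) n]
    have h2 : (n : ℝ) = (n + 1 : ℕ) * (1 + -(1 / ((n + 1 : ℕ) : ℝ))) := by
      field_simp
      push_cast
      ring
    have h3 : (0 : ℝ) ≤ 1 + -(1 / ((n + 1 : ℕ) : ℝ)) := by
      have : (1 : ℝ) / ((n + 1 : ℕ) : ℝ) ≤ 1 := by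
        rw [div_le_one hn]
        push_cast
        linarith [Nat.cast_nonneg (α := ℝ) n]
      linarith
    have h4 : (n : ℝ) ^ (1 - a) ≤
        ((n + 1 : ℕ) : ℝ) ^ (1 - a) - (1 - a) * ((n + 1 : ℕ) : ℝ) ^ (-a) := by
      have h5 : ((n + 1 : ℕ) : ℝ) ^ (-a) = ((n + 1 : ℕ) : ℝ) ^ (1 - a) / ((n + 1 : ℕ) : ℝ) := by
        rw [← Real.rpow_sub_one hn.ne']
        congr 1
        ring
      rw [h5, h2, Real.mul_rpow hn.le h3]
      have := mul_le_mul_of_nonneg_left hb (Real.rpow_nonneg hn.le (1 - a))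
      refine this.trans_eq ?_
      field_simp
      ring
    calc _ ≤ (n : ℝ) ^ (1 - a) / (1 - a) + ((n + 1 : ℕ) : ℝ) ^ (-a) := by gcongr
      _ ≤ (((n + 1 : ℕ) : ℝ) ^ (1 - a) - (1 - a) * ((n + 1 : ℕ) : ℝ) ^ (-a)) / (1 - a) +
          ((n + 1 : ℕ) : ℝ) ^ (-a) := by gcongr
      _ = _ := by field_simp; ring

theorem sum_weight_sq_le {γ : ℝ} (hγ : 0 < γ) (hγ2 : 2 * γ < 1) (hN : 0 < N) :
    1 / (N : ℝ) * ∑ u : Vtx N, weight γ u ^ 2 ≤ 1 / (1 - 2 * γ) := by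
  have hN' : (0 : ℝ) < N := by exact_mod_cast hN
  have h1 : ∀ u : Vtx N, weight γ u ^ 2 = (N : ℝ) ^ (2 * γ) * (u.1 : ℝ) ^ (-(2 * γ)) := by
    intro u
    unfold weight
    rw [← Real.rpow_natCast, ← Real.rpow_mul (div_pos hN' u.pos).le,
      Real.div_rpow hN'.le u.pos.le, Real.rpow_neg u.pos.le, div_eq_mul_inv]
    norm_num [mul_comm]
  have h2 : ∑ u : Vtx N, (u.1 : ℝ) ^ (-(2 * γ)) =
      ∑ i ∈ Finset.Icc 1 N, (i : ℝ) ^ (-(2 * γ)) :=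
    Finset.sum_coe_sort (Finset.Icc 1 N) fun i => (i : ℝ) ^ (-(2 * γ))
  simp only [h1]
  rw [← Finset.mul_sum, h2]
  calc _ ≤ 1 / (N : ℝ) * ((N : ℝ) ^ (2 * γ) * ((N : ℝ) ^ (1 - 2 * γ) / (1 - 2 * γ))) := by
        gcongr
        exact sum_rpow_neg_le (by linarith) hγ2 N
    _ = 1 / (N : ℝ) * ((N : ℝ) ^ (2 * γ) * (N : ℝ) ^ (1 - 2 * γ)) / (1 - 2 * γ) := by ring
    _ = _ := by
        rw [← Real.rpow_add hN', show 2 * γ + (1 - 2 * γ) = 1 by ring, Real.rpow_one]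
        field_simp

open Classical in
/-- The weights above the level `x` carry a proportion of order `x ^ (-(1 - γ) / γ)` of the total
weight. -/
theorem sum_heavy_weight_le {γ x : ℝ} (hγ : 0 < γ) (hγ2 : 2 * γ < 1) (hN : 0 < N) (hx : 0 < x) :
    1 / (N : ℝ) * ∑ u : Vtx N with x < weight γ u, weight γ u ≤
      x ^ (-((1 - γ) / γ)) / (1 - γ) := by
  have hN' : (0 : ℝ) < N := by exact_mod_cast hN
  have h1 : ∀ u : Vtx N, weight γ u = (N : ℝ) ^ γ * (u.1 : ℝ) ^ (-γ) := by
    intro u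
    unfold weight
    rw [Real.div_rpow hN'.le u.pos.le, Real.rpow_neg u.pos.le, div_eq_mul_inv]
  -- the largest label of a vertex of weight at least `x`
  set J : ℝ := N * x ^ (-(1 / γ)) with hJ
  have hJ0 : 0 < J := mul_pos hN' (Real.rpow_pos_of_pos hx _)
  have hle : ∀ u : Vtx N, x < weight γ u → (u.1 : ℝ) ≤ J := by
    intro u hu
    have h2 : x ^ (1 / γ) ≤ N / u.1 := by
      calc x ^ (1 / γ) ≤ (weight γ u) ^ (1 / γ) := by gcongr
        _ = N / u.1 := by
          unfold weight
          rw [one_div, Real.rpow_rpow_inv (div_pos hN' u.pos).le hγ.ne']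
    rw [le_div_iff₀ u.pos] at h2
    rw [hJ, Real.rpow_neg hx.le, ← div_eq_mul_inv, le_div_iff₀ (Real.rpow_pos_of_pos hx _),
      mul_comm]
    exact h2
  have h3 : ∑ u : Vtx N with x < weight γ u, weight γ u ≤
      (N : ℝ) ^ γ * ∑ i ∈ Finset.Icc 1 ⌊J⌋₊, (i : ℝ) ^ (-γ) := by
    rw [Finset.mul_sum]
    calc ∑ u : Vtx N with x < weight γ u, weight γ u
        = ∑ i ∈ (Finset.univ.filter fun u : Vtx N => x < weight γ u).image Subtype.val,
            (N : ℝ) ^ γ * (i : ℝ) ^ (-γ) := by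
          rw [Finset.sum_image fun a _ b _ hab => Subtype.ext hab]
          exact Finset.sum_congr rfl fun u _ => h1 u
      _ ≤ _ := by
          refine Finset.sum_le_sum_of_subset_of_nonneg (fun i hi => ?_) fun i _ _ => by positivity
          obtain ⟨u, hu, rfl⟩ := Finset.mem_image.1 hi
          exact Finset.mem_Icc.2 ⟨(Finset.mem_Icc.1 u.2).1,
            Nat.le_floor (hle u (Finset.mem_filter.1 hu).2)⟩
  have h1γ : 0 < 1 - γ := by linarith
  calc _ ≤ 1 / (N : ℝ) * ((N : ℝ) ^ γ * ((⌊J⌋₊ : ℝ) ^ (1 - γ) / (1 - γ))) := by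
        refine mul_le_mul_of_nonneg_left (h3.trans ?_) (by positivity)
        gcongr
        exact sum_rpow_neg_le hγ.le (by linarith) _
    _ ≤ 1 / (N : ℝ) * ((N : ℝ) ^ γ * (J ^ (1 - γ) / (1 - γ))) := by
        gcongr
        exact Nat.floor_le hJ0.le
    _ = 1 / (N : ℝ) * ((N : ℝ) ^ γ * (N : ℝ) ^ (1 - γ)) * x ^ (-((1 - γ) / γ)) / (1 - γ) := by
        rw [hJ, Real.mul_rpow hN'.le (Real.rpow_nonneg hx.le _), ← Real.rpow_mul hx.le,
          show -(1 / γ) * (1 - γ) = -((1 - γ) / γ) by ring]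
        ring
    _ = _ := by
        rw [← Real.rpow_add hN', show γ + (1 - γ) = 1 by ring, Real.rpow_one]
        field_simp

/-! ### Clusters of the Chung–Lu graph -/

open Classical in
theorem percExp_clEdgeProb_connected_le {β γ : ℝ} (hβ : 0 < β) (hγ : 0 < γ)
    (hβγ : β + 2 * γ < 1) {j k : Vtx N} (hjk : k ≠ j) (T : Finset (Sym2 (Vtx N))) :
    percExp (clEdgeProb β γ N) T (fun A => if j ∈ cluster {k} A then 1 else 0) ≤
      1 / (1 - β / (1 - 2 * γ)) * (β / N) * weight γ k * weight γ j := by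
  have hN : (0 : ℝ) < N := zero_lt_one.trans_le k.one_le_N
  have hw : ∀ v : Vtx N, 0 < weight γ v := fun v => zero_lt_one.trans_le (one_le_weight hγ v)
  have hν : 0 < 1 - β / (1 - 2 * γ) := by
    rw [sub_pos, div_lt_one (by linarith)]
    linarith
  set C := 1 / (1 - β / (1 - 2 * γ)) with hC
  have hC0 : 0 < C := by positivity
  -- `C = 1 + ν C` with the mean offspring number `ν = β / (1 - 2 γ)`
  have hC1 : 1 + β / (1 - 2 * γ) * C = C := by
    rw [hC]
    field_simp
    ring
  refine percExp_connected_le (fun e => (clEdgeProb_pos hβ e).le)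
    (fun e => (clEdgeProb_le hβ hγ (by linarith) e).trans (by linarith)) hjk
    (h := fun v => C * (β / N) * weight γ v * weight γ j) (fun v => ?_) (fun v => ?_) T
  · have := hw v
    have := hw j
    positivity
  · have hS := sum_weight_sq_le hγ (by linarith) (by exact_mod_cast hN : 0 < N)
    calc ∑ u, clEdgeProb β γ N s(v, u) *
          ((if u = j then 1 else 0) + C * (β / N) * weight γ u * weight γ j)
        ≤ ∑ u, β / N * weight γ v * weight γ u *
          ((if u = j then 1 else 0) + C * (β / N) * weight γ u * weight γ j) := by
          refine Finset.sum_le_sum fun u _ => ?_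
          refine mul_le_mul_of_nonneg_right (clProb_le_weight v u) ?_
          have := hw u
          have := hw j
          split_ifs <;> positivity
      _ = β / N * weight γ v * weight γ j +
          β / N * weight γ v * weight γ j * C * β * (1 / N * ∑ u, weight γ u ^ 2) := by
          simp only [mul_add, Finset.sum_add_distrib, mul_ite, mul_one, mul_zero,
            Finset.sum_ite_eq', Finset.mem_univ, if_true]
          congr 1
          rw [Finset.mul_sum, Finset.mul_sum]
          exact Finset.sum_congr rfl fun u _ => by ring
      _ ≤ β / N * weight γ v * weight γ j +
          β / N * weight γ v * weight γ j * C * β * (1 / (1 - 2 * γ)) := by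
          have := hw v
          have := hw j
          gcongr
      _ = β / N * weight γ v * weight γ j * (1 + β / (1 - 2 * γ) * C) := by ring
      _ = _ := by rw [hC1]; ring

open Classical in
theorem percExp_clEdgeProb_exp_clusterEdges_le {β γ θ κ : ℝ} (hβ : 0 < β) (hγ : 0 < γ)
    (hβγ : β + 2 * γ < 1) (hθ : 0 ≤ θ) (hκ : 0 ≤ κ) (W : Set (Vtx N))
    (h : β / N * ∑ u with u ∈ W, weight γ u * (Real.exp ((1 + κ) * θ * weight γ u) - 1) ≤ κ * θ)
    (k : Vtx N) :
    percExp (clEdgeProb β γ N) (pairsIn W) (fun A => Real.exp (θ * clusterEdges {k} A)) ≤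
      Real.exp (κ * θ * weight γ k) := by
  have hw : ∀ v : Vtx N, 0 < weight γ v := fun v => zero_lt_one.trans_le (one_le_weight hγ v)
  refine percExp_exp_clusterEdges_le_of_subset (fun e => (clEdgeProb_pos hβ e).le)
    (fun e => (clEdgeProb_le hβ hγ (by linarith) e).trans (by linarith)) hθ
    (a := fun v => κ * θ * weight γ v) (fun v => ?_) W (fun v => ?_)
    (fun e he => (mem_pairsIn.1 he).2) k
  · have := hw v
    positivity
  · calc ∑ u with u ∈ W, clEdgeProb β γ N s(v, u) * (Real.exp (θ + κ * θ * weight γ u) - 1)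
        ≤ ∑ u with u ∈ W, β / N * weight γ v * weight γ u *
            (Real.exp ((1 + κ) * θ * weight γ u) - 1) := by
          refine Finset.sum_le_sum fun u _ => ?_
          have h1 := hw u
          have h2 : θ + κ * θ * weight γ u ≤ (1 + κ) * θ * weight γ u := by
            nlinarith [one_le_weight hγ u]
          have h3 : 0 ≤ θ + κ * θ * weight γ u := by positivity
          refine mul_le_mul (clProb_le_weight v u)
            (sub_le_sub_right (Real.exp_le_exp.2 h2) 1)
            (sub_nonneg.2 (Real.one_le_exp h3)) ?_
          have := hw v
          positivity
      _ = weight γ v * (β / N * ∑ u with u ∈ W,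
            weight γ u * (Real.exp ((1 + κ) * θ * weight γ u) - 1)) := by
          rw [Finset.mul_sum, Finset.mul_sum]
          exact Finset.sum_congr rfl fun u _ => by ring
      _ ≤ weight γ v * (κ * θ) := by
          have := hw v
          gcongr
      _ = _ := by ring

open Classical in
/-- Chernoff bound for the number of edges of a cluster. -/
theorem percExp_clEdgeProb_clusterEdges_gt_le {β γ θ κ : ℝ} (hβ : 0 < β) (hγ : 0 < γ)
    (hβγ : β + 2 * γ < 1) (hθ : 0 ≤ θ) (hκ : 0 ≤ κ) (W : Set (Vtx N))
    (h : β / N * ∑ u with u ∈ W, weight γ u * (Real.exp ((1 + κ) * θ * weight γ u) - 1) ≤ κ * θ)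
    (k : Vtx N) (x : ℝ) :
    percExp (clEdgeProb β γ N) (pairsIn W) (fun A => if x < clusterEdges {k} A then 1 else 0) ≤
      Real.exp (κ * θ * weight γ k - θ * x) := by
  calc _ ≤ percExp (clEdgeProb β γ N) (pairsIn W)
          (fun A => Real.exp (-(θ * x)) * Real.exp (θ * clusterEdges {k} A)) := by
        refine percExp_mono (fun e _ => (clEdgeProb_pos hβ e).le)
          (fun e _ => (clEdgeProb_le hβ hγ (by linarith) e).trans (by linarith)) fun A _ => ?_
        rw [← Real.exp_add]
        split_ifs with hx
        · exact Real.one_le_exp (by nlinarith)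
        · exact (Real.exp_pos _).le
    _ = Real.exp (-(θ * x)) * percExp (clEdgeProb β γ N) (pairsIn W)
          (fun A => Real.exp (θ * clusterEdges {k} A)) := percExp_const_mul _ _ _ _
    _ ≤ Real.exp (-(θ * x)) * Real.exp (κ * θ * weight γ k) := by
        gcongr
        exact percExp_clEdgeProb_exp_clusterEdges_le hβ hγ hβγ hθ hκ W h k
    _ = _ := by rw [← Real.exp_add]; ring_nf

open Classical in
/-- The subcriticality condition of the exponential moment bound. The constants `δ` and `κ`
depend only on `β` and `γ`: vertices with `(1 + κ) θ w_u ≤ δ` are light, and the contribution of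
the others is left as a separate hypothesis. -/
theorem exists_chernoff_constants {β γ : ℝ} (hβ : 0 < β) (hγ : 0 < γ) (hβγ : β + 2 * γ < 1) :
    ∃ δ κ : ℝ, 0 < δ ∧ 0 < κ ∧ ∀ (N : ℕ) (θ : ℝ) (W : Set (Vtx N)), 0 < N → 0 < θ →
      (β / N * ∑ u with u ∈ W ∧ δ < (1 + κ) * θ * weight γ u,
        weight γ u * Real.exp ((1 + κ) * θ * weight γ u) ≤ θ) →
      β / N * ∑ u with u ∈ W, weight γ u * (Real.exp ((1 + κ) * θ * weight γ u) - 1) ≤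
        κ * θ := by
  have h2γ : 0 < 1 - 2 * γ := by linarith
  set ν := β / (1 - 2 * γ) with hν
  have hν0 : 0 < ν := div_pos hβ h2γ
  have hν1 : ν < 1 := by
    rw [hν, div_lt_one h2γ]
    linarith
  -- `δ` is chosen with `ν e ^ δ = ν' := (1 + ν) / 2 < 1`
  set ν' := (1 + ν) / 2 with hν'
  have hδ : 0 < Real.log (ν' / ν) := Real.log_pos (by rw [one_lt_div hν0]; linarith)
  have hexp : ν * Real.exp (Real.log (ν' / ν)) = ν' := by
    rw [Real.exp_log (by positivity)]
    field_simp
  set δ := Real.log (ν' / ν) with hδdef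
  have hν'1 : 0 < 1 - ν' := by linarith
  -- `κ` is chosen with `ν' (1 + κ) + 1 ≤ κ`
  set κ := 2 / (1 - ν') with hκ
  have hκ0 : 0 < κ := by positivity
  have hκ1 : ν' * (1 + κ) + 1 ≤ κ := by
    have : κ * (1 - ν') = 2 := by rw [hκ]; field_simp
    nlinarith
  refine ⟨δ, κ, hδ, hκ0, fun N θ W hN hθ hheavy => ?_⟩
  have hN' : (0 : ℝ) < N := by exact_mod_cast hN
  have hw : ∀ v : Vtx N, 0 < weight γ v := fun v => zero_lt_one.trans_le (one_le_weight hγ v)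
  have hterm : ∀ u : Vtx N, weight γ u * (Real.exp ((1 + κ) * θ * weight γ u) - 1) ≤
      Real.exp δ * ((1 + κ) * θ) * weight γ u ^ 2 +
      if δ < (1 + κ) * θ * weight γ u then
        weight γ u * Real.exp ((1 + κ) * θ * weight γ u) else 0 := by
    intro u
    have hu := hw u
    set y := (1 + κ) * θ * weight γ u with hy
    have hy0 : 0 < y := by positivity
    have h1 : Real.exp δ * ((1 + κ) * θ) * weight γ u ^ 2 = weight γ u * (y * Real.exp δ) := by
      rw [hy]
      ring
    rw [h1]
    split_ifs with hc
    · have : 0 ≤ weight γ u * (y * Real.exp δ) := by positivity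
      nlinarith
    · rw [add_zero]
      refine mul_le_mul_of_nonneg_left ?_ hu.le
      have h2 : Real.exp y - 1 ≤ y * Real.exp y := by
        have h3 := Real.add_one_le_exp (-y)
        have h4 : Real.exp (-y) * Real.exp y = 1 := by rw [← Real.exp_add]; simp
        nlinarith [Real.exp_pos y]
      refine h2.trans ?_
      gcongr
      exact not_lt.1 hc
  calc β / N * ∑ u with u ∈ W, weight γ u * (Real.exp ((1 + κ) * θ * weight γ u) - 1)
      ≤ β / N * ∑ u with u ∈ W, (Real.exp δ * ((1 + κ) * θ) * weight γ u ^ 2 +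
          if δ < (1 + κ) * θ * weight γ u then
            weight γ u * Real.exp ((1 + κ) * θ * weight γ u) else 0) := by
        gcongr with u
        exact hterm u
    _ = β / N * ∑ u with u ∈ W, Real.exp δ * ((1 + κ) * θ) * weight γ u ^ 2 +
        β / N * ∑ u with u ∈ W ∧ δ < (1 + κ) * θ * weight γ u,
          weight γ u * Real.exp ((1 + κ) * θ * weight γ u) := by
        rw [Finset.sum_add_distrib, mul_add, ← Finset.sum_filter, Finset.filter_filter]
    _ ≤ β / N * ∑ u, Real.exp δ * ((1 + κ) * θ) * weight γ u ^ 2 + θ := by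
        refine add_le_add (mul_le_mul_of_nonneg_left ?_ (by positivity)) hheavy
        exact Finset.sum_le_sum_of_subset_of_nonneg (Finset.subset_univ _)
          fun u _ _ => by positivity
    _ = β * Real.exp δ * ((1 + κ) * θ) * (1 / N * ∑ u, weight γ u ^ 2) + θ := by
        rw [← Finset.mul_sum]
        ring
    _ ≤ β * Real.exp δ * ((1 + κ) * θ) * (1 / (1 - 2 * γ)) + θ := by
        gcongr
        exact sum_weight_sq_le hγ (by linarith) hN
    _ = (ν * Real.exp δ * (1 + κ) + 1) * θ := by
        rw [hν]
        ring
    _ ≤ κ * θ := by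
        rw [hexp]
        gcongr

/-! ### High probability events -/

theorem WHP.of_measure_compl_le {Ω : ℕ → Type*} [∀ N, MeasurableSpace (Ω N)]
    {μ : ∀ N, Measure (Ω N)} [∀ N, IsProbabilityMeasure (μ N)] {A : ∀ N, Set (Ω N)}
    {ε : ℕ → ℝ} (hε : Tendsto ε atTop (𝓝 0))
    (h : ∀ᶠ N in atTop, μ N (A N)ᶜ ≤ ENNReal.ofReal (ε N)) : WHP μ A := by
  have h1 : Tendsto (fun N => 1 - ENNReal.ofReal (ε N)) atTop (𝓝 1) := by
    have := ENNReal.Tendsto.sub (tendsto_const_nhds (x := (1 : ENNReal)))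
      (ENNReal.tendsto_ofReal hε) (Or.inl ENNReal.one_ne_top)
    simpa using this
  refine tendsto_of_tendsto_of_tendsto_of_le_of_le' h1 tendsto_const_nhds ?_
    (Eventually.of_forall fun N => prob_le_one)
  filter_upwards [h] with N hN
  rw [tsub_le_iff_right]
  calc (1 : ENNReal) = μ N Set.univ := measure_univ.symm
    _ ≤ μ N (A N) + μ N (A N)ᶜ := by
      rw [← Set.union_compl_self (A N)]
      exact measure_union_le _ _
    _ ≤ _ := by gcongr

/-- Union bound over the `N` vertices, each with an event of probability `O(N⁻²)`. -/
theorem measure_exists_vertex_le {Ω : Type*} [MeasurableSpace Ω] {μ : Measure Ω}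
    {R : Vtx N → Ω → Prop} {D : ℝ} (hD : 0 ≤ D)
    (h : ∀ i, μ {ω | R i ω} ≤ ENNReal.ofReal (D * Real.exp (-(2 * Real.log N)))) :
    μ {ω | ∃ i, R i ω} ≤ ENNReal.ofReal (D / N) := by
  have h1 : {ω | ∃ i, R i ω} = ⋃ i, {ω | R i ω} := by
    ext ω
    simp
  rw [h1]
  refine (measure_iUnion_fintype_le _ _).trans ((Finset.sum_le_sum fun i _ => h i).trans ?_)
  rw [← ENNReal.ofReal_sum_of_nonneg fun i _ => by positivity]
  refine ENNReal.ofReal_le_ofReal ?_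
  rw [Finset.sum_const, Finset.card_univ, Fintype.card_coe, Nat.card_Icc, nsmul_eq_mul]
  rcases Nat.eq_zero_or_pos N with rfl | hN
  · simp
  · have hN' : (0 : ℝ) < N := by exact_mod_cast hN
    have h2 : Real.exp (-(2 * Real.log N)) = ((N : ℝ) ^ 2)⁻¹ := by
      rw [Real.exp_neg, two_mul, Real.exp_add, Real.exp_log hN', sq]
    rw [h2]
    refine le_of_eq ?_
    push_cast [Nat.add_sub_cancel]
    field_simp

theorem sqrt_exp_sub_four_mul (a l : ℝ) :
    √(Real.exp (a - 4 * l)) = Real.exp (a / 2) * Real.exp (-(2 * l)) := by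
  rw [← Real.exp_add, Real.sqrt_eq_iff_eq_sq (Real.exp_pos _).le (Real.exp_pos _).le,
    ← Real.exp_nat_mul]
  congr 1
  push_cast
  ring

theorem tendsto_log_natCast_atTop : Tendsto (fun N : ℕ => Real.log N) atTop atTop :=
  Real.tendsto_log_atTop.comp tendsto_natCast_atTop_atTop

/-! ### Components of vertices of low weight -/

theorem weight_le_of_kGamma_lt {γ : ℝ} (hγ : 0 < γ) (hγ2 : 2 * γ < 1) (hL : 1 ≤ Real.log N)
    {u : Vtx N} (hu : kGamma γ N < u.1) : weight γ u ≤ (N : ℝ) ^ (γ / (2 - 2 * γ)) := by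
  have hN : (0 : ℝ) < N := zero_lt_one.trans_le u.one_le_N
  have h1 : (N : ℝ) ^ ((1 - 2 * γ) / (2 - 2 * γ)) ≤ u.1 := by
    refine le_trans ?_ hu.le
    unfold kGamma
    exact le_mul_of_one_le_right (Real.rpow_nonneg hN.le _) hL
  have h2 : (N : ℝ) / u.1 ≤ (N : ℝ) ^ (1 / (2 - 2 * γ)) := by
    rw [div_le_iff₀ u.pos]
    calc (N : ℝ) = (N : ℝ) ^ (1 / (2 - 2 * γ)) * (N : ℝ) ^ ((1 - 2 * γ) / (2 - 2 * γ)) := by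
          rw [← Real.rpow_add hN, ← add_div, show 1 + (1 - 2 * γ) = 2 - 2 * γ by ring,
            div_self (by linarith), Real.rpow_one]
      _ ≤ _ := by gcongr
  unfold weight
  calc _ ≤ ((N : ℝ) ^ (1 / (2 - 2 * γ))) ^ γ :=
        Real.rpow_le_rpow (div_pos hN u.pos).le h2 hγ.le
    _ = _ := by
      rw [← Real.rpow_mul hN.le]
      congr 1
      ring

theorem kGamma_lt_of_notMem_vBig {γ : ℝ} {G : SimpleGraph (Vtx N)} {i w : Vtx N}
    (hi : i ∉ vBig γ G) (hw : G.Reachable i w) : kGamma γ N < w.1 := by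
  by_contra hle
  refine hi (Set.mem_iUnion₂.2 ⟨w, not_lt.1 hle, ?_⟩)
  rw [SimpleGraph.ConnectedComponent.mem_supp_iff, SimpleGraph.ConnectedComponent.eq]
  exact hw

/-- Without the first `K_γ` vertices, the maximal weight is at most `N ^ (γ / (2 - 2 γ))`, and
Chernoff bounds at the inverse of this scale give every component at once. -/
theorem isBigOPLog_maxSmallTotalDegree {β γ : ℝ} (hβ : 0 < β) (hγ : 0 < γ)
    (hβγ : β + 2 * γ < 1) {Ω : ℕ → Type*} [∀ N, MeasurableSpace (Ω N)]
    {μ : ∀ N, Measure (Ω N)} [∀ N, IsProbabilityMeasure (μ N)]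
    {G : ∀ N, Ω N → SimpleGraph (Vtx N)} (hG : InClass β γ μ G) :
    IsBigOPLog μ (fun N ω => (maxSmallTotalDegree γ (G N ω) : ℝ))
      (fun N _ => (N : ℝ) ^ (γ / (2 - 2 * γ))) := by
  classical
  obtain ⟨C, hC, hcont⟩ := hG.exists_measure_le_sqrt hβ hγ hβγ
  obtain ⟨δ, κ, hδ, hκ, hcher⟩ := exists_chernoff_constants hβ hγ hβγ
  set B : ℝ := 4 * (1 + κ) / δ with hB
  set D : ℝ := C * Real.exp (δ / 2) with hD
  refine ⟨2, two_pos, WHP.of_measure_compl_le (ε := fun N => D / N)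
    (tendsto_const_nhds.div_atTop tendsto_natCast_atTop_atTop) ?_⟩
  filter_upwards [hcont, tendsto_log_natCast_atTop.eventually_ge_atTop (max 1 (2 * B)),
    eventually_gt_atTop 0] with N hcontN hL hN
  have hL1 : 1 ≤ Real.log N := (le_max_left _ _).trans hL
  have hLB : 2 * B ≤ Real.log N := (le_max_right _ _).trans hL
  have hN' : (0 : ℝ) < N := by exact_mod_cast hN
  set L := Real.log N with hLdef
  set M : ℝ := (N : ℝ) ^ (γ / (2 - 2 * γ)) with hM
  have hM0 : 0 < M := Real.rpow_pos_of_pos hN' _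
  set W : Set (Vtx N) := {u | kGamma γ N < u.1} with hW
  have hWM : ∀ u ∈ W, weight γ u ≤ M := fun u hu => weight_le_of_kGamma_lt hγ (by linarith) hL1 hu
  set θ : ℝ := δ / ((1 + κ) * M) with hθ
  have hθ0 : 0 < θ := by positivity
  have hlight : ∀ u ∈ W, (1 + κ) * θ * weight γ u ≤ δ := by
    intro u hu
    calc (1 + κ) * θ * weight γ u ≤ (1 + κ) * θ * M := by gcongr; exact hWM u hu
      _ = δ := by rw [hθ]; field_simp
  have hcond := hcher N θ W hN hθ0 (by
    rw [Finset.filter_false_of_mem fun u _ hu => not_lt.2 (hlight u hu.1) hu.2]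
    simpa using hθ0.le)
  have hevent : ∀ i : Vtx N,
      μ N {ω | i ∈ W ∧ M * (B * L) < clusterEdges {i} (edgesIn (G N ω) (pairsIn W))} ≤
        ENNReal.ofReal (D * Real.exp (-(2 * L))) := by
    intro i
    by_cases hi : i ∈ W
    · simp only [hi, true_and]
      refine (hcontN (pairsIn W) (fun e he => (mem_pairsIn.1 he).1)
        (fun A => M * (B * L) < clusterEdges {i} A)).trans (ENNReal.ofReal_le_ofReal ?_)
      rw [hD, mul_assoc, ← sqrt_exp_sub_four_mul]
      gcongr
      refine (percExp_clEdgeProb_clusterEdges_gt_le hβ hγ hβγ hθ0.le hκ.le W hcond i _).trans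
        (Real.exp_le_exp.2 ?_)
      have h1 : θ * (M * (B * L)) = 4 * L := by
        rw [hθ, hB]
        field_simp
      have h2 := hlight i hi
      have h3 : 0 ≤ θ * weight γ i := mul_nonneg hθ0.le (zero_le_one.trans (one_le_weight hγ i))
      nlinarith
    · simp [hi]
  refine (measure_mono fun ω hω => ?_).trans (measure_exists_vertex_le (by positivity) hevent)
  by_contra hnot
  refine hω ?_
  change (maxSmallTotalDegree γ (G N ω) : ℝ) ≤ M * L ^ (2 : ℝ)
  have hnot' : ∀ i ∈ W, (clusterEdges {i} (edgesIn (G N ω) (pairsIn W)) : ℝ) ≤ M * (B * L) :=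
    fun i hi => not_lt.1 fun hlt => hnot ⟨i, hi, hlt⟩
  have hL0 : 0 ≤ L := zero_le_one.trans hL1
  rw [← Nat.le_floor_iff (by positivity)]
  refine Finset.sup_le fun i hi => Nat.le_floor ?_
  have hi' : i ∉ vBig γ (G N ω) := by simpa using hi
  have hreach : ∀ w, (G N ω).Reachable i w → w ∈ W := fun w hw => kGamma_lt_of_notMem_vBig hi' hw
  calc (totalDegree (G N ω) i : ℝ)
      ≤ 2 * clusterEdges {i} (edgesIn (G N ω) (pairsIn W)) := by
        exact_mod_cast totalDegree_le_clusterEdges hreach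
    _ ≤ 2 * (M * (B * L)) := by
        gcongr
        exact hnot' i (hreach i (SimpleGraph.Reachable.refl i))
    _ = M * ((2 * B) * L) := by ring
    _ ≤ M * (L * L) := by gcongr
    _ = M * L ^ (2 : ℝ) := by rw [Real.rpow_two, sq]

/-! ### Components of the vertices up to the threshold -/

/-- For `k ≤ K_γ`, the power `w_k ^ (1 - α)` with the tail exponent `α = (1 - γ) / γ` of the
size-biased weight distribution is, up to a power of `log N`, at most a negative power of `N`. -/
theorem weight_mul_rpow_le {γ : ℝ} (hγ : 0 < γ) (hγ2 : 2 * γ < 1) (hL : 0 < Real.log N)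
    {k : Vtx N} (hk : (k.1 : ℝ) ≤ kGamma γ N) :
    weight γ k * weight γ k ^ (-((1 - γ) / γ)) ≤
      (N : ℝ) ^ (-((1 - 2 * γ) / (2 - 2 * γ))) * Real.log N ^ (1 - 2 * γ) := by
  have hN : (0 : ℝ) < N := zero_lt_one.trans_le k.one_le_N
  have hw : 0 < weight γ k := zero_lt_one.trans_le (one_le_weight hγ k)
  have h1γ : 1 - γ ≠ 0 := by linarith
  calc weight γ k * weight γ k ^ (-((1 - γ) / γ))
      = weight γ k ^ (1 - (1 - γ) / γ) := by
        rw [sub_eq_add_neg 1 ((1 - γ) / γ), Real.rpow_add hw, Real.rpow_one]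
    _ = ((k.1 : ℝ) / N) ^ (1 - 2 * γ) := by
        unfold weight
        rw [← Real.rpow_mul (div_pos hN k.pos).le, ← inv_div,
          Real.inv_rpow (div_pos k.pos hN).le, ← Real.rpow_neg (div_pos k.pos hN).le]
        congr 1
        field_simp
        ring
    _ ≤ (kGamma γ N / N) ^ (1 - 2 * γ) :=
        Real.rpow_le_rpow (div_pos k.pos hN).le (by gcongr) (by linarith)
    _ = _ := by
        have h1 : kGamma γ N / N =
            (N : ℝ) ^ ((1 - 2 * γ) / (2 - 2 * γ) - 1) * Real.log N := by
          unfold kGamma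
          rw [Real.rpow_sub_one hN.ne']
          ring
        rw [h1, Real.mul_rpow (Real.rpow_nonneg hN.le _) hL.le, ← Real.rpow_mul hN.le]
        congr 2
        field_simp
        ring

open Classical in
/-- The expected number of pairs `(k, j)` with `k ≤ K_γ` and `j` in the cluster of `k`, where the
weight of `j` exceeds that of `k` by the factor `c log N`. -/
theorem percExp_exists_heavy_le {β γ c : ℝ} (hβ : 0 < β) (hγ : 0 < γ) (hβγ : β + 2 * γ < 1)
    (hc : 0 < c) (hL : 0 < Real.log N) (hcL : 1 ≤ c * Real.log N) (hN : 0 < N)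
    (T : Finset (Sym2 (Vtx N))) :
    percExp (clEdgeProb β γ N) T (fun A => if ∃ k : Vtx N, (k.1 : ℝ) ≤ kGamma γ N ∧
        ∃ j : Vtx N, c * weight γ k * Real.log N < weight γ j ∧ j ∈ cluster {k} A
        then 1 else 0) ≤
      1 / (1 - β / (1 - 2 * γ)) * β * c ^ (-((1 - γ) / γ)) / (1 - γ) *
        Real.log N ^ (-((1 - γ) * (1 / γ - 2))) := by
  have hN' : (0 : ℝ) < N := by exact_mod_cast hN
  set L := Real.log N with hLdef
  set C := 1 / (1 - β / (1 - 2 * γ)) with hC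
  have hC0 : 0 < C := by
    rw [hC, one_div_pos, sub_pos, div_lt_one (by linarith)]
    linarith
  have hw : ∀ v : Vtx N, 0 < weight γ v := fun v => zero_lt_one.trans_le (one_le_weight hγ v)
  have h1γ : 0 < 1 - γ := by linarith
  set α := (1 - γ) / γ with hα
  set X : ℝ := C * β * c ^ (-α) / (1 - γ) * L ^ (-α) *
    ((N : ℝ) ^ (-((1 - 2 * γ) / (2 - 2 * γ))) * L ^ (1 - 2 * γ)) with hX
  have hvertex : ∀ k : Vtx N, (k.1 : ℝ) ≤ kGamma γ N →
      ∑ j : Vtx N with c * weight γ k * L < weight γ j,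
        percExp (clEdgeProb β γ N) T (fun A => if j ∈ cluster {k} A then 1 else 0) ≤ X := by
    intro k hk
    have hwk := hw k
    calc _ ≤ ∑ j : Vtx N with c * weight γ k * L < weight γ j,
          C * (β / N) * weight γ k * weight γ j := by
          refine Finset.sum_le_sum fun j hj => ?_
          refine percExp_clEdgeProb_connected_le hβ hγ hβγ ?_ T
          rintro rfl
          have := (Finset.mem_filter.1 hj).2
          nlinarith
      _ = C * β * weight γ k *
          (1 / N * ∑ j : Vtx N with c * weight γ k * L < weight γ j, weight γ j) := by
          rw [Finset.mul_sum, Finset.mul_sum]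
          exact Finset.sum_congr rfl fun j _ => by ring
      _ ≤ C * β * weight γ k * ((c * weight γ k * L) ^ (-α) / (1 - γ)) := by
          gcongr
          exact sum_heavy_weight_le hγ (by linarith) hN (by positivity)
      _ = C * β * c ^ (-α) / (1 - γ) * L ^ (-α) * (weight γ k * weight γ k ^ (-α)) := by
          rw [Real.mul_rpow (by positivity) hL.le, Real.mul_rpow hc.le hwk.le]
          ring
      _ ≤ X := by
          rw [hX]
          exact mul_le_mul_of_nonneg_left (weight_mul_rpow_le hγ (by linarith) hL hk)
            (by positivity)
  have hX0 : 0 ≤ X := by positivity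
  have hK0 : 0 ≤ kGamma γ N := mul_nonneg (Real.rpow_nonneg hN'.le _) hL.le
  have hcard : ((Finset.univ.filter fun k : Vtx N => (k.1 : ℝ) ≤ kGamma γ N).card : ℝ) ≤
      kGamma γ N := by
    refine le_trans ?_ (Nat.floor_le hK0)
    have h1 : (Finset.univ.filter fun k : Vtx N => (k.1 : ℝ) ≤ kGamma γ N).card ≤
        (Finset.Icc 1 ⌊kGamma γ N⌋₊).card := by
      refine Finset.card_le_card_of_injOn Subtype.val (fun k hk => ?_)
        fun a _ b _ hab => Subtype.ext hab
      exact Finset.mem_coe.2 (Finset.mem_Icc.2 ⟨(Finset.mem_Icc.1 k.2).1,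
        Nat.le_floor (Finset.mem_filter.1 (Finset.mem_coe.1 hk)).2⟩)
    rw [Nat.card_Icc, Nat.add_sub_cancel] at h1
    exact_mod_cast h1
  calc _ ≤ percExp (clEdgeProb β γ N) T (fun A =>
          ∑ k : Vtx N with (k.1 : ℝ) ≤ kGamma γ N,
            ∑ j : Vtx N with c * weight γ k * L < weight γ j,
              if j ∈ cluster {k} A then 1 else 0) := by
        refine percExp_mono (fun e _ => (clEdgeProb_pos hβ e).le)
          (fun e _ => (clEdgeProb_le hβ hγ (by linarith) e).trans (by linarith)) fun A _ => ?_
        have hnn : ∀ k j : Vtx N, (0 : ℝ) ≤ if j ∈ cluster {k} A then 1 else 0 := fun k j => by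
          split_ifs <;> norm_num
        split_ifs with h
        · obtain ⟨k, hk, j, hj, hjA⟩ := h
          calc (1 : ℝ) = if j ∈ cluster {k} A then 1 else 0 := (if_pos hjA).symm
            _ ≤ ∑ j : Vtx N with c * weight γ k * L < weight γ j,
                  if j ∈ cluster {k} A then 1 else 0 :=
                Finset.single_le_sum (f := fun j => if j ∈ cluster {k} A then (1 : ℝ) else 0)
                  (fun j _ => hnn k j) (by simpa using hj)
            _ ≤ _ := Finset.single_le_sum
                  (f := fun k => ∑ j : Vtx N with c * weight γ k * L < weight γ j,
                    if j ∈ cluster {k} A then (1 : ℝ) else 0)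
                  (fun k _ => Finset.sum_nonneg fun j _ => hnn k j) (by simpa using hk)
        · exact Finset.sum_nonneg fun k _ => Finset.sum_nonneg fun j _ => hnn k j
    _ = ∑ k : Vtx N with (k.1 : ℝ) ≤ kGamma γ N,
          ∑ j : Vtx N with c * weight γ k * L < weight γ j,
            percExp (clEdgeProb β γ N) T (fun A => if j ∈ cluster {k} A then 1 else 0) := by
        rw [percExp_sum]
        exact Finset.sum_congr rfl fun k _ => percExp_sum _ _ _ _
    _ ≤ ∑ k : Vtx N with (k.1 : ℝ) ≤ kGamma γ N, X :=
        Finset.sum_le_sum fun k hk => hvertex k (Finset.mem_filter.1 hk).2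
    _ ≤ kGamma γ N * X := by
        rw [Finset.sum_const, nsmul_eq_mul]
        gcongr
    _ = C * β * c ^ (-α) / (1 - γ) * (L ^ (-α) * L * L ^ (1 - 2 * γ)) *
          ((N : ℝ) ^ ((1 - 2 * γ) / (2 - 2 * γ)) * (N : ℝ) ^ (-((1 - 2 * γ) / (2 - 2 * γ)))) := by
        rw [hX, kGamma]
        ring
    _ = _ := by
        rw [← Real.rpow_add hN', add_neg_cancel, Real.rpow_zero, mul_one,
          ← Real.rpow_add_one hL.ne', ← Real.rpow_add hL]
        congr 2
        rw [hα]
        field_simp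
        ring

/-- With high probability no vertex `k ≤ K_γ` is connected to one whose weight exceeds `w_k` by the
factor `c log N`, and inside the remaining vertices the cluster of `k` obeys a Chernoff bound at the
scale `w_k`. -/
theorem whp_totalDegree_le {β γ : ℝ} (hβ : 0 < β) (hγ : 0 < γ)
    (hβγ : β + 2 * γ < 1) {Ω : ℕ → Type*} [∀ N, MeasurableSpace (Ω N)]
    {μ : ∀ N, Measure (Ω N)} [∀ N, IsProbabilityMeasure (μ N)]
    {G : ∀ N, Ω N → SimpleGraph (Vtx N)} (hG : InClass β γ μ G) :
    WHP μ (fun N => {ω | ∀ k : Vtx N, (k.1 : ℝ) ≤ kGamma γ N →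
      (totalDegree (G N ω) k : ℝ) / ((N : ℝ) / (k.1 : ℝ)) ^ γ ≤ Real.log N}) := by
  classical
  obtain ⟨C, hC, hcont⟩ := hG.exists_measure_le_sqrt hβ hγ hβγ
  obtain ⟨δ, κ, hδ, hκ, hcher⟩ := exists_chernoff_constants hβ hγ hβγ
  have h1γ : 0 < 1 - γ := by linarith
  have hη : 0 < (1 - 2 * γ) / (2 - 2 * γ) := div_pos (by linarith) (by linarith)
  set η := (1 - 2 * γ) / (2 - 2 * γ) with hηdef
  set α := (1 - γ) / γ with hα
  -- with this `c`, a vertex of weight `c w_k log N` costs the factor `N ^ (η / 2)` at `θ = 8 / w_k`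
  set c := η / (16 * (1 + κ)) with hc
  have hc0 : 0 < c := by positivity
  set d := δ / (8 * (1 + κ)) with hd
  have hd0 : 0 < d := by positivity
  set D : ℝ := C * Real.exp (8 * κ / 2) with hD
  set D₁ : ℝ := 1 / (1 - β / (1 - 2 * γ)) * β * c ^ (-α) / (1 - γ) with hD₁
  set D₂ : ℝ := β * d ^ (-α) / (1 - γ) with hD₂
  have hD₂0 : 0 < D₂ := by positivity
  set a : ℝ := (1 - γ) * (1 / γ - 2) with ha
  have ha0 : 0 < a := mul_pos h1γ (by
    rw [sub_pos, lt_div_iff₀ hγ]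
    exact hβγ.trans' (by linarith))
  have hsmall : Tendsto (fun N : ℕ => (N : ℝ) ^ (-(η / 2)) * Real.log N ^ (1 - 2 * γ)) atTop
      (𝓝 0) := by
    have h1 := (isLittleO_log_rpow_rpow_atTop (1 - 2 * γ)
      (half_pos hη)).tendsto_div_nhds_zero.comp tendsto_natCast_atTop_atTop
    refine h1.congr fun N => ?_
    simp only [Function.comp_apply]
    rw [Real.rpow_neg (Nat.cast_nonneg N), div_eq_mul_inv, mul_comm]
  have hεlim : Tendsto (fun N : ℕ => C * √(D₁ * Real.log N ^ (-a)) + D / N) atTop (𝓝 0) := by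
    have h1 : Tendsto (fun N : ℕ => D₁ * Real.log N ^ (-a)) atTop (𝓝 0) := by
      simpa using ((tendsto_rpow_neg_atTop ha0).comp tendsto_log_natCast_atTop).const_mul D₁
    have h2 : Tendsto (fun N : ℕ => D / (N : ℝ)) atTop (𝓝 0) :=
      tendsto_const_nhds.div_atTop tendsto_natCast_atTop_atTop
    simpa using (h1.sqrt.const_mul C).add h2
  refine WHP.of_measure_compl_le hεlim ?_
  filter_upwards [hcont, tendsto_log_natCast_atTop.eventually_ge_atTop (max 1 (1 / c)),
    eventually_gt_atTop 0, hsmall.eventually (gt_mem_nhds (show 0 < 8 / D₂ by positivity))]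
    with N hcontN hL hN hsmallN
  have hL1 : 1 ≤ Real.log N := (le_max_left _ _).trans hL
  have hcL : 1 ≤ c * Real.log N := by
    have := (le_max_right _ _).trans hL
    rwa [div_le_iff₀ hc0, mul_comm] at this
  have hN' : (0 : ℝ) < N := by exact_mod_cast hN
  have hL0 : 0 < Real.log N := zero_lt_one.trans_le hL1
  set L := Real.log N with hLdef
  have hw : ∀ v : Vtx N, 0 < weight γ v := fun v => zero_lt_one.trans_le (one_le_weight hγ v)
  set P : Finset (Sym2 (Vtx N)) → Prop := fun A => ∃ k : Vtx N, (k.1 : ℝ) ≤ kGamma γ N ∧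
    ∃ j : Vtx N, c * weight γ k * L < weight γ j ∧ j ∈ cluster {k} A with hP
  set W : Vtx N → Set (Vtx N) := fun k => {u | weight γ u ≤ c * weight γ k * L} with hW
  have hheavy : μ N {ω | P (edgesIn (G N ω) (pairsIn Set.univ))} ≤
      ENNReal.ofReal (C * √(D₁ * L ^ (-a))) := by
    refine (hcontN (pairsIn Set.univ) (fun e he => (mem_pairsIn.1 he).1) P).trans
      (ENNReal.ofReal_le_ofReal ?_)
    gcongr
    refine Eq.trans_le ?_
      (percExp_exists_heavy_le hβ hγ hβγ hc0 hL0 hcL hN (pairsIn Set.univ))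
    congr!
  have hcond : ∀ k : Vtx N, (k.1 : ℝ) ≤ kGamma γ N →
      β / N * ∑ u with u ∈ W k,
        weight γ u * (Real.exp ((1 + κ) * (8 / weight γ k) * weight γ u) - 1) ≤
      κ * (8 / weight γ k) := by
    intro k hk
    have hwk := hw k
    refine hcher N (8 / weight γ k) (W k) hN (by positivity) ?_
    have hterm : ∀ u ∈ W k,
        Real.exp ((1 + κ) * (8 / weight γ k) * weight γ u) ≤ (N : ℝ) ^ (η / 2) := by
      intro u hu
      rw [Real.rpow_def_of_pos hN', Real.exp_le_exp]
      calc (1 + κ) * (8 / weight γ k) * weight γ u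
          ≤ (1 + κ) * (8 / weight γ k) * (c * weight γ k * L) := by gcongr; exact hu
        _ = L * (η / 2) := by
          rw [hc]
          field_simp
          ring
    calc _ ≤ β / N * ∑ u : Vtx N with d * weight γ k < weight γ u,
            weight γ u * (N : ℝ) ^ (η / 2) := by
          gcongr
          refine (Finset.sum_le_sum fun u hu => mul_le_mul_of_nonneg_left
            (hterm u (Finset.mem_filter.1 hu).2.1) (hw u).le).trans ?_
          refine Finset.sum_le_sum_of_subset_of_nonneg (fun u hu => ?_) fun u _ _ => ?_
          · have h1 := (Finset.mem_filter.1 hu).2.2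
            refine Finset.mem_filter.2 ⟨Finset.mem_univ _, ?_⟩
            have h2 : (1 + κ) * (8 / weight γ k) * weight γ u =
                8 * (1 + κ) * weight γ u / weight γ k := by ring
            rw [h2, lt_div_iff₀ hwk] at h1
            rw [hd, div_mul_eq_mul_div, div_lt_iff₀ (by positivity)]
            linarith
          · have := hw u
            positivity
      _ = β * (N : ℝ) ^ (η / 2) *
            (1 / N * ∑ u : Vtx N with d * weight γ k < weight γ u, weight γ u) := by
          rw [← Finset.sum_mul]
          ring
      _ ≤ β * (N : ℝ) ^ (η / 2) * ((d * weight γ k) ^ (-α) / (1 - γ)) := by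
          gcongr
          exact sum_heavy_weight_le hγ (by linarith) hN (by positivity)
      _ = D₂ * (N : ℝ) ^ (η / 2) * (weight γ k * weight γ k ^ (-α)) / weight γ k := by
          rw [Real.mul_rpow hd0.le hwk.le, hD₂]
          field_simp
      _ ≤ D₂ * (N : ℝ) ^ (η / 2) * ((N : ℝ) ^ (-η) * L ^ (1 - 2 * γ)) / weight γ k := by
          refine div_le_div_of_nonneg_right (mul_le_mul_of_nonneg_left
            (weight_mul_rpow_le hγ (by linarith) hL0 hk) (by positivity)) hwk.le
      _ = D₂ * ((N : ℝ) ^ (-(η / 2)) * L ^ (1 - 2 * γ)) / weight γ k := by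
          rw [show -(η / 2) = η / 2 + -η by ring, Real.rpow_add hN']
          ring
      _ ≤ D₂ * (8 / D₂) / weight γ k := by gcongr
      _ = 8 / weight γ k := by field_simp
  have hlight : ∀ k : Vtx N, μ N {ω | (k.1 : ℝ) ≤ kGamma γ N ∧
      weight γ k * L / 2 < clusterEdges {k} (edgesIn (G N ω) (pairsIn (W k)))} ≤
        ENNReal.ofReal (D * Real.exp (-(2 * L))) := by
    intro k
    by_cases hk : (k.1 : ℝ) ≤ kGamma γ N
    · simp only [hk, true_and]
      have hwk := hw k
      refine (hcontN (pairsIn (W k)) (fun e he => (mem_pairsIn.1 he).1)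
        (fun A => weight γ k * L / 2 < clusterEdges {k} A)).trans (ENNReal.ofReal_le_ofReal ?_)
      rw [hD, mul_assoc, ← sqrt_exp_sub_four_mul]
      gcongr
      refine (percExp_clEdgeProb_clusterEdges_gt_le hβ hγ hβγ (by positivity) hκ.le (W k)
        (hcond k hk) k _).trans_eq ?_
      congr 1
      field_simp
      ring
    · simp [hk]
  have hunion := measure_exists_vertex_le (by positivity) hlight
  have hL00 : 0 ≤ C * √(D₁ * L ^ (-a)) := by positivity
  rw [ENNReal.ofReal_add hL00 (by positivity)]
  refine le_trans ((measure_mono fun ω hω => ?_).trans (measure_union_le _ _))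
    (add_le_add hheavy hunion)
  by_contra hnot
  refine hω fun k hk => ?_
  have hreach : ∀ w, (G N ω).Reachable k w → w ∈ W k := by
    intro w hkw
    refine not_lt.1 fun hlt => hnot (Or.inl ⟨k, hk, w, hlt, ?_⟩)
    exact mem_cluster_of_reachable (fun _ _ => Set.mem_univ _) hkw
  have hsize : (clusterEdges {k} (edgesIn (G N ω) (pairsIn (W k))) : ℝ) ≤ weight γ k * L / 2 :=
    not_lt.1 fun hlt => hnot (Or.inr ⟨k, hk, hlt⟩)
  change (totalDegree (G N ω) k : ℝ) / weight γ k ≤ L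
  rw [div_le_iff₀ (hw k)]
  calc (totalDegree (G N ω) k : ℝ)
      ≤ 2 * clusterEdges {k} (edgesIn (G N ω) (pairsIn (W k))) := by
        exact_mod_cast totalDegree_le_clusterEdges hreach
    _ ≤ 2 * (weight γ k * L / 2) := by gcongr
    _ = L * weight γ k := by ring

end SubcriticalIRG

theorem mainTheorem8 (β γ : ℝ) (hβ : 0 < β) (hγ : 0 < γ) (hβγ : β + 2 * γ < 1)
    {Ω : ℕ → Type*} [∀ N, MeasurableSpace (Ω N)]
    (μ : ∀ N, Measure (Ω N)) [∀ N, IsProbabilityMeasure (μ N)]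
    (G : ∀ N, Ω N → SimpleGraph (SubcriticalIRG.Vtx N))
    (hG : SubcriticalIRG.InClass β γ μ G) :
    SubcriticalIRG.WHP μ (fun N => {ω | ∀ k : SubcriticalIRG.Vtx N,
        (k.1 : ℝ) ≤ SubcriticalIRG.kGamma γ N →
        (SubcriticalIRG.totalDegree (G N ω) k : ℝ) / ((N : ℝ) / (k.1 : ℝ)) ^ γ ≤ Real.log N}) ∧
    SubcriticalIRG.IsBigOPLog μ
      (fun N ω => (SubcriticalIRG.maxSmallTotalDegree γ (G N ω) : ℝ))
      (fun N _ => (N : ℝ) ^ (γ / (2 - 2 * γ))) :=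
  ⟨SubcriticalIRG.whp_totalDegree_le hβ hγ hβγ hG,
    SubcriticalIRG.isBigOPLog_maxSmallTotalDegree hβ hγ hβγ hG⟩
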